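/- **Notation.** Let $\lambda>0$ and $d\mu_\lambda(t)=\operatorname{sh}^{2\lambda}t\,dt$ on $[0,\infty)$; write $|E|_\lambda=\mu_\lambda(E)$. For $1\le p<\infty$, $L_{p,\lambda}$ is the space of (real- or complex-valued) measurable $f$ on $[1,\infty)$ with $\|f\|_{L_{p,\lambda}}=\big(\int_0^\infty|f(\operatorname{ch}t)|^p\operatorname{sh}^{2\lambda}t\,dt\big)^{1/p}<\infty$. The generalized shift is $$A^\lambda_{\operatorname{ch}t}f(\operatorname{ch}x)=\frac{\Gamma(\lambda+\frac12)}{\Gamma(\frac12)\Gamma(\lambda)}\int_0^\pi f(\operatorname{ch}x\operatorname{ch}t-\operatorname{sh}x\operatorname{sh}t\cos\varphi)(\sin\varphi)^{2\lambda-1}d\varphi .$$ For $0<\alpha<2\lambda+1$ the Riesz–Gegenbauer fractional integral is $$\Im^\alpha_Gf(\operatorname{ch}x)=\int_0^\infty \big(A^\lambda_{\operatorname{ch}t}(\operatorname{sh}x)^{\alpha-2\lambda-1}\big)f(\operatorname{ch}t)\operatorname{sh}^{2\lambda}t\,dt ,$$ where the shift acts on the function $\operatorname{ch}x\mapsto(\operatorname{sh}x)^{\alpha-2\lambda-1}$.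 For $0<\lambda<\frac12$ the Riesz–Gegenbauer potential is $$I^\alpha_Gf(\operatorname{ch}t)=\frac1{\Gamma(\alpha/2)}\int_0^\infty\Big(\int_0^\infty r^{\frac\alpha2-1}h_r(\operatorname{ch}x)\,dr\Big)A^\lambda_{\operatorname{ch}t}f(\operatorname{ch}x)\operatorname{sh}^{2\lambda}x\,dx,$$ $$h_r(\operatorname{ch}x)=\int_1^\infty e^{-\gamma(\gamma+2\lambda)r}P^\lambda_\gamma(\operatorname{ch}x)(\gamma^2-1)^{\lambda-\frac12}d\gamma,$$ $$P^\lambda_\gamma(y)=\frac{\Gamma(\gamma+2\lambda)\cos\pi\lambda}{\Gamma(\lambda)\Gamma(\gamma+\lambda+1)}(2y)^{-\gamma-2\lambda}\,{}_2F_1\Big(\frac\gamma2+\lambda,\frac\gamma2+\lambda+\frac12;\gamma+\lambda+1;\frac1{y^2}\Big).$$ **Theorem 3.** Let $\lambda>0$, $0<\alpha<2\lambda+1$, $1\le p<\frac{2\lambda+1}{\alpha}$ and $\frac1p-\frac1q=\frac{\alpha}{2\lambda+1}$. (a) If $f\in L_{p,\lambda}$, then the integral $\Im^\alpha_Gf(\operatorname{ch}x)$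 converges absolutely for almost every $x\in[0,\infty)$. (b) If $1<p<\frac{2\lambda+1}{\alpha}$, then there is a constant $c>0$ depending only on $\alpha,\lambda,p$ such that for every $f\in L_{p,\lambda}$ one has $\Im^\alpha_Gf\in L_{q,\lambda}$ and $\|\Im^\alpha_Gf\|_{L_{q,\lambda}}\le c\,\|f\|_{L_{p,\lambda}}$. If moreover $0<\lambda<\frac12$, then, with a constant $c>0$ depending only on $\alpha,\lambda,p$, for every $f\in L_{p,\lambda}$ the integrals defining $I^\alpha_Gf(\operatorname{ch}t)$ converge absolutely for almost every $t$ (the inner ones for almost every value of the outer variable), $I^\alpha_Gf\in L_{q,\lambda}$, and $$\|I^\alpha_Gf\|_{L_{q,\lambda}}\le c\,\big\|\Im^\alpha_G|f|\big\|_{L_{q,\lambda}},\qquad \|I^\alpha_Gf\|_{L_{q,\lambda}}\le c\,\|f\|_{L_{p,\lambda}} .$$ (c) If $p=1$, so that $\frac1q=1-\frac{\alpha}{2\lambda+1}$, then there is a constant $c>0$ depending only on $\alpha,\lambda$ such that for all $f\in L_{1,\lambda}$ and all $\beta>0$ $$\big|\{t\in[0,\infty):|\Im^\alpha_Gf(\operatorname{ch}t)|>\beta\}\big|_\lambda\le\Big(\frac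 c\beta\|f\|_{L_{1,\lambda}}\Big)^q .$$ -/

import Mathlib

open Real MeasureTheory Set

noncomputable section

/-- The measure `dμ(t) = sh^{2λ} t dt` on `[0, ∞)`. -/
def gegenbauerMeasure (lam : ℝ) : Measure ℝ :=
  (volume.restrict (Ici (0 : ℝ))).withDensity (fun t => ENNReal.ofReal (sinh t ^ (2 * lam)))

/-- `f`, a function on `[1, ∞)`, belongs to `L_{p,λ}[0, ∞)`: the function `t ↦ f (ch t)` is
measurable (up to null sets) and its `p`-th power norm with respect to `sh^{2λ} t dt` is finite. -/
def MemGegenbauerLp {E : Type*} [NormedAddCommGroup E] (lam p : ℝ) (f : ℝ → E) : Prop :=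
  MemLp (fun t => f (cosh t)) (ENNReal.ofReal p) (gegenbauerMeasure lam)

/-- The norm `‖f‖_{L_{p,λ}} = (∫₀^∞ |f (ch t)|^p sh^{2λ} t dt)^{1/p}`. -/
def gegenbauerNorm {E : Type*} [NormedAddCommGroup E] (lam p : ℝ) (f : ℝ → E) : ENNReal :=
  eLpNorm (fun t => f (cosh t)) (ENNReal.ofReal p) (gegenbauerMeasure lam)

/-- The integrand of the generalized shift. -/
def gegenbauerShiftIntegrand {E : Type*} [NormedAddCommGroup E] [NormedSpace ℝ E]
    (lam t : ℝ) (f : ℝ → E) (x φ : ℝ) : E :=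
  (sin φ ^ (2 * lam - 1)) • f (cosh x * cosh t - sinh x * sinh t * cos φ)

/-- The generalized shift `A_{ch t}^λ f (ch x)`, for a function `f` on `[1, ∞)`. -/
def gegenbauerShift {E : Type*} [NormedAddCommGroup E] [NormedSpace ℝ E]
    (lam t : ℝ) (f : ℝ → E) (x : ℝ) : E :=
  (Gamma (lam + 1 / 2) / (Gamma (1 / 2) * Gamma lam)) •
    ∫ φ in (0 : ℝ)..π, gegenbauerShiftIntegrand lam t f x φ

/-- The function of `y = ch x` whose value at `ch x` is `(sh x)^{α - 2λ - 1}` (`x ≥ 0`). -/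
def rieszKernel (lam α : ℝ) (y : ℝ) : ℝ := √(y ^ 2 - 1) ^ (α - 2 * lam - 1)

/-- The Riesz–Gegenbauer fractional integral as a function of `x`:
`ℑ_G^α f (ch x) = ∫₀^∞ A_{ch t}^λ (sh x)^{α - 2λ - 1} f (ch t) sh^{2λ} t dt`. -/
def rieszFractionalIntegral {E : Type*} [NormedAddCommGroup E] [NormedSpace ℝ E]
    (lam α : ℝ) (f : ℝ → E) (x : ℝ) : E :=
  ∫ t, gegenbauerShift lam t (rieszKernel lam α) x • f (cosh t) ∂(gegenbauerMeasure lam)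

/-- The integral defining `ℑ_G^α f (ch x)` converges absolutely (the inner integral, which defines
the shifted kernel, for almost every `t`, and then the outer one). -/
def RieszFractionalIntegralConverges {E : Type*} [NormedAddCommGroup E] [NormedSpace ℝ E]
    (lam α : ℝ) (f : ℝ → E) (x : ℝ) : Prop :=
  (∀ᵐ t ∂(gegenbauerMeasure lam),
    IntervalIntegrable (gegenbauerShiftIntegrand lam t (rieszKernel lam α) x) volume 0 π) ∧
  Integrable (fun t => gegenbauerShift lam t (rieszKernel lam α) x • f (cosh t))
    (gegenbauerMeasure lam)

/-- The eigenfunction `P_γ^λ (y)`, `y > 1`, of the Gegenbauer operator `G` for the eigenvalue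
`γ (γ + 2λ)` that decays at infinity. -/
def gegenbauerP (lam γ y : ℝ) : ℝ :=
  Gamma (γ + 2 * lam) * cos (π * lam) / (Gamma lam * Gamma (γ + lam + 1)) *
    (2 * y) ^ (-γ - 2 * lam) *
    ordinaryHypergeometric (γ / 2 + lam) (γ / 2 + lam + 1 / 2) (γ + lam + 1) (1 / y ^ 2)

/-- The integrand of `h_r (ch x)`. -/
def gegenbauerHeatIntegrand (lam r x γ : ℝ) : ℝ :=
  exp (-(γ * (γ + 2 * lam) * r)) * gegenbauerP lam γ (cosh x) * (γ ^ 2 - 1) ^ (lam - 1 / 2)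

/-- The kernel
`h_r (ch x) = ∫₁^∞ e^{-γ (γ + 2λ) r} P_γ^λ (ch x) (γ² - 1)^{λ - 1/2} dγ` associated with `G`. -/
def gegenbauerHeat (lam r x : ℝ) : ℝ :=
  ∫ γ in Ioi (1 : ℝ), gegenbauerHeatIntegrand lam r x γ

/-- The Riesz–Gegenbauer potential as a function of `t`:
`I_G^α f (ch t) =
  Γ(α/2)⁻¹ ∫₀^∞ (∫₀^∞ r^{α/2 - 1} h_r (ch x) dr) A_{ch t}^λ f (ch x) sh^{2λ} x dx`. -/
def rieszPotential {E : Type*} [NormedAddCommGroup E] [NormedSpace ℝ E]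
    (lam α : ℝ) (f : ℝ → E) (t : ℝ) : E :=
  (1 / Gamma (α / 2)) •
    ∫ x, (∫ r in Ioi (0 : ℝ), r ^ (α / 2 - 1) * gegenbauerHeat lam r x) •
      gegenbauerShift lam t f x ∂(gegenbauerMeasure lam)

/-- All the integrals in the definition of `I_G^α f (ch t)` converge absolutely (the inner ones for
almost every `x`). -/
def RieszPotentialConverges {E : Type*} [NormedAddCommGroup E] [NormedSpace ℝ E]
    (lam α : ℝ) (f : ℝ → E) (t : ℝ) : Prop :=
  (∀ᵐ x ∂(gegenbauerMeasure lam),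
    (∀ r, 0 < r → IntegrableOn (gegenbauerHeatIntegrand lam r x) (Ioi (1 : ℝ))) ∧
    IntegrableOn (fun r => r ^ (α / 2 - 1) * gegenbauerHeat lam r x) (Ioi (0 : ℝ)) ∧
    IntervalIntegrable (gegenbauerShiftIntegrand lam t f x) volume 0 π) ∧
  Integrable (fun x => (∫ r in Ioi (0 : ℝ), r ^ (α / 2 - 1) * gegenbauerHeat lam r x) •
    gegenbauerShift lam t f x) (gegenbauerMeasure lam)

end

/-!
The generalized shift is convolution of radial functions on a hyperbolic space of (not necessarily
integral) dimension `n = 2λ + 1`: `A_{ch t} f (ch x)` averages `f` over the third side of the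
hyperbolic triangles with two sides `x`, `t`. The pairs `(x, φ)`, with the measure
`sh^{2λ} x sin^{2λ-1} φ dx dφ`, are polar coordinates on the upper half of the hyperboloid
`X₀² = 1 + X₁² + X₂²`, weighted by `X₂^{2λ-1}`. In the coordinates `X₂ = w`,
`(X₀, X₁) = √(1+w²) (ch s, sh s)` a Lorentz boost is a translation of `s`, so that the shift is
self-adjoint (`lintegral_coshSide_symm`, from the reflection `s ↦ t - s`) and preserves the measure
up to a constant (`lintegral_coshSide`). Consequently `shiftConv k f` obeys the Young inequalities
`L¹ * L¹ → L¹`, `L¹ * L^∞ → L^∞` and `L^{p'} * L^p → L^∞`.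

The Riesz kernel `sh^{α-n}` is cut at `sh u = ρ`. Because `ch ≥ 1`, the measure is at most
`v^{2λ} dv` in the variable `v = sh u`, so the near part has `L¹` norm `O(ρ^α)`, and the far part
has `L^{p'}` norm `O(ρ^{-n/q})`, exactly as in `ℝⁿ`. For the strong type (`p > 1`) and a height `β`,
choose `ρ` so that the far part contributes at most `β / 2`, and split `f` at the height
`a ∼ β^{q/p}` below which the near part contributes at most `β / 4`. What remains gives
`μ {k * f > β} ≤ a⁻¹ ∫_{f > a} f`, and integrating this against `q β^{q-1} dβ` yields
`∫ (k * f)^q ≲ ∫ f^p` (`lintegral_rpow_le_of_level_estimate`) without any interpolation theorem. For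
`p = 1` the same cut gives the weak type (`shiftConv_weak_type`).

The potential is controlled by the fractional integral since its kernel is `O(sh^{α-n})`
(`lintegral_gegenbauerHeat_le`). The duplication formula and the log-convexity of `Γ` bound the
coefficients of the hypergeometric series of `P_γ (1)` uniformly in `γ` by a convergent series,
which is where `λ < 1/2` enters; hence `|P_γ (ch x)| ≤ C ch^{-γ-2λ} x`
(`abs_gegenbauerP_le`). Bernoulli's inequality gives `ch^{-γ-2λ} x ≤ C (γ sh² x)^{-(n-α)/2}`
(`cosh_rpow_le`), after which the integrals over `r` and `γ` converge. Self-adjointness of the shift then moves it from `f` to the kernel.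
-/

open scoped ENNReal

noncomputable section

/-! ### Geometry of the generalized shift -/

/-- The measure `sin^{2λ-1} φ dφ` on `(0, π)`, over which the generalized shift averages. -/
def angularMeasure (lam : ℝ) : Measure ℝ :=
  (volume.restrict (Ioo (0 : ℝ) π)).withDensity (fun φ => ENNReal.ofReal (sin φ ^ (2 * lam - 1)))

/-- `ch x ch t - sh x sh t cos φ`, the hyperbolic cosine of the third side of a hyperbolic triangle
with sides `x`, `t` enclosing the angle `φ`. -/
def coshSide (x t φ : ℝ) : ℝ := cosh x * cosh t - sinh x * sinh t * cos φ

lemma measurable_density (lam : ℝ) :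
    Measurable (fun t => ENNReal.ofReal (sinh t ^ (2 * lam))) := by fun_prop

lemma measurable_angular_density (lam : ℝ) :
    Measurable (fun φ => ENNReal.ofReal (sin φ ^ (2 * lam - 1))) := by fun_prop

instance (lam : ℝ) : SFinite (gegenbauerMeasure lam) := by
  unfold gegenbauerMeasure; infer_instance

instance (lam : ℝ) : SFinite (angularMeasure lam) := by
  unfold angularMeasure; infer_instance

lemma lintegral_gegenbauerMeasure (lam : ℝ) (f : ℝ → ℝ≥0∞) :
    ∫⁻ x, f x ∂(gegenbauerMeasure lam)
      = ∫⁻ x in Ioi 0, ENNReal.ofReal (sinh x ^ (2 * lam)) * f x := by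
  rw [gegenbauerMeasure, lintegral_withDensity_eq_lintegral_mul_non_measurable₀ _
    (measurable_density lam).aemeasurable (by simp), ← restrict_Ioi_eq_restrict_Ici]
  rfl

lemma lintegral_angularMeasure (lam : ℝ) (f : ℝ → ℝ≥0∞) :
    ∫⁻ φ, f φ ∂(angularMeasure lam)
      = ∫⁻ φ in Ioo 0 π, ENNReal.ofReal (sin φ ^ (2 * lam - 1)) * f φ := by
  rw [angularMeasure, lintegral_withDensity_eq_lintegral_mul_non_measurable₀ _
    (measurable_angular_density lam).aemeasurable (by simp)]
  rfl

lemma ae_gegenbauerMeasure_pos (lam : ℝ) : ∀ᵐ x ∂(gegenbauerMeasure lam), 0 < x := by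
  rw [gegenbauerMeasure, ← restrict_Ioi_eq_restrict_Ici]
  exact (withDensity_absolutelyContinuous _ _).ae_le (ae_restrict_mem measurableSet_Ioi)

lemma lintegral_comp_mul_sinh {c : ℝ} (hc : 0 < c) (J : ℝ → ℝ≥0∞) :
    ∫⁻ a, J a = ∫⁻ s, ENNReal.ofReal (c * cosh s) * J (c * sinh s) := by
  have himg : (fun s => c * sinh s) '' univ = univ := by
    rw [image_univ, range_eq_univ]
    intro a
    obtain ⟨s, hs⟩ := sinh_surjective (a / c)
    exact ⟨s, by simp only [hs]; field_simp⟩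
  have h := lintegral_image_eq_lintegral_abs_deriv_mul (s := univ) MeasurableSet.univ
    (f := fun s => c * sinh s) (f' := fun s => c * cosh s)
    (fun s _ => ((hasDerivAt_sinh s).const_mul c).hasDerivWithinAt)
    (fun x _ y _ hxy => sinh_injective (mul_left_cancel₀ hc.ne' hxy)) J
  rw [himg, setLIntegral_univ, setLIntegral_univ] at h
  rw [h]
  congr 1 with s
  rw [abs_of_pos (mul_pos hc (cosh_pos s))]

lemma lintegral_Ioi_comp_sinh (J : ℝ → ℝ≥0∞) :
    ∫⁻ r in Ioi 0, J r = ∫⁻ x in Ioi 0, ENNReal.ofReal (cosh x) * J (sinh x) := by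
  have himg : sinh '' Ioi 0 = Ioi 0 := by
    ext a
    constructor
    · rintro ⟨s, hs, rfl⟩
      exact sinh_pos_iff.2 hs
    · intro ha
      obtain ⟨s, rfl⟩ := sinh_surjective a
      exact ⟨s, sinh_pos_iff.1 ha, rfl⟩
  have h := lintegral_image_eq_lintegral_abs_deriv_mul (s := Ioi 0) measurableSet_Ioi
    (f := sinh) (f' := cosh) (fun s _ => (hasDerivAt_sinh s).hasDerivWithinAt)
    (sinh_injective.injOn) J
  rw [himg] at h
  rw [h]
  congr 1 with s
  rw [abs_of_pos (cosh_pos s)]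

/-- Polar coordinates on the upper half-plane. -/
lemma lintegral_polar_upper (Φ : ℝ → ℝ → ℝ≥0∞) (hΦ : Measurable (Function.uncurry Φ)) :
    ∫⁻ w in Ioi 0, ∫⁻ a, Φ a w
      = ∫⁻ r in Ioi 0, ∫⁻ θ in Ioo 0 π, ENNReal.ofReal r * Φ (r * cos θ) (r * sin θ) := by
  set S : Set (ℝ × ℝ) := {p | 0 < p.2} with hS
  have hSm : MeasurableSet S := measurableSet_lt measurable_const measurable_snd
  have h := lintegral_comp_polarCoord_symm (S.indicator (Function.uncurry Φ))
  have hm : Measurable (S.indicator (Function.uncurry Φ)) := hΦ.indicator hSm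
  have hL : ∫⁻ p : ℝ × ℝ, S.indicator (Function.uncurry Φ) p = ∫⁻ w in Ioi 0, ∫⁻ a, Φ a w := by
    rw [Measure.volume_eq_prod, lintegral_prod_symm _ hm.aemeasurable,
      ← lintegral_indicator measurableSet_Ioi]
    congr 1 with w
    by_cases hw : 0 < w
    · simp [indicator, hS, hw]
    · simp [indicator, hS, hw]
  rw [← hL, ← h]
  have ht : polarCoord.target = Ioi (0 : ℝ) ×ˢ Ioo (-π) π := rfl
  rw [ht, Measure.volume_eq_prod, ← Measure.prod_restrict, lintegral_prod]
  · refine setLIntegral_congr_fun measurableSet_Ioi fun r hr => ?_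
    simp only [polarCoord_symm_apply, smul_eq_mul]
    rw [← lintegral_indicator measurableSet_Ioo, ← lintegral_indicator measurableSet_Ioo]
    congr 1 with θ
    have hr' : (0:ℝ) < r := hr
    by_cases h1 : θ ∈ Ioo 0 π
    · have h2 : θ ∈ Ioo (-π) π := ⟨by linarith [h1.1, pi_pos], h1.2⟩
      have h3 : 0 < r * sin θ := mul_pos hr' (sin_pos_of_mem_Ioo h1)
      simp [indicator, hS, h1, h2, sin_pos_of_mem_Ioo h1, hr']
    · rw [indicator_of_notMem h1]
      by_cases h2 : θ ∈ Ioo (-π) π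
      · have h3 : sin θ ≤ 0 := by
          apply sin_nonpos_of_nonpos_of_neg_pi_le _ h2.1.le
          by_contra h
          exact h1 ⟨not_le.1 h, h2.2⟩
        have : ¬ (0 < r * sin θ) := not_lt.2 (mul_nonpos_of_nonneg_of_nonpos hr'.le h3)
        rw [indicator_of_mem h2, indicator_of_notMem (by simpa [hS] using this), mul_zero]
      · rw [indicator_of_notMem h2]
  · refine Measurable.aemeasurable ?_
    simp only [polarCoord_symm_apply, smul_eq_mul]
    exact Measurable.mul (by fun_prop) (hm.comp (by fun_prop))

/-- Integration over the upper half of the hyperboloid `X₀² = 1 + X₁² + X₂²` against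
`X₂^{2λ-1}` times the hyperbolic area: geodesic polar coordinates on the left, and on the right the
coordinates `X₂ = w`, `(X₀, X₁) = √(1+w²) (ch s, sh s)`, in which Lorentz boosts of the
`(X₀, X₁)`-plane are the translations of `s`. -/
lemma lintegral_hyperboloid (lam : ℝ) (H : ℝ → ℝ → ℝ≥0∞) (hH : Measurable (Function.uncurry H)) :
    ∫⁻ x, ∫⁻ φ, H (cosh x) (sinh x * cos φ) ∂(angularMeasure lam) ∂(gegenbauerMeasure lam)
      = ∫⁻ w in Ioi 0, ∫⁻ s, ENNReal.ofReal (w ^ (2 * lam - 1)) *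
          H (√(1 + w ^ 2) * cosh s) (√(1 + w ^ 2) * sinh s) := by
  set Φ : ℝ → ℝ → ℝ≥0∞ := fun a w => ENNReal.ofReal (w ^ (2 * lam - 1)) *
    (ENNReal.ofReal (1 / √(1 + a ^ 2 + w ^ 2)) * H (√(1 + a ^ 2 + w ^ 2)) a) with hΦ
  have hΦm : Measurable (Function.uncurry Φ) := by
    refine Measurable.mul (by fun_prop) (Measurable.mul (by fun_prop) ?_)
    exact hH.comp (f := fun p : ℝ × ℝ => (√(1 + p.1 ^ 2 + p.2 ^ 2), p.1)) (by fun_prop)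
  have hR : ∀ w : ℝ, ∫⁻ a, Φ a w = ∫⁻ s, ENNReal.ofReal (w ^ (2 * lam - 1)) *
          H (√(1 + w ^ 2) * cosh s) (√(1 + w ^ 2) * sinh s) := by
    intro w
    have hc : 0 < √(1 + w ^ 2) := by positivity
    rw [lintegral_comp_mul_sinh hc]
    congr 1 with s
    have h1 : √(1 + (√(1 + w ^ 2) * sinh s) ^ 2 + w ^ 2) = √(1 + w ^ 2) * cosh s := by
      rw [sqrt_eq_iff_mul_self_eq (by positivity) (by positivity)]
      have h2 : √(1 + w ^ 2) ^ 2 = 1 + w ^ 2 := sq_sqrt (by positivity)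
      have h3 := cosh_sq s
      linear_combination -√(1 + w ^ 2) ^ 2 * h3 - h2
    simp only [hΦ, h1]
    have h4 : ENNReal.ofReal (√(1 + w ^ 2) * cosh s) * ENNReal.ofReal (1 / (√(1 + w ^ 2) * cosh s))
        = 1 := by
      have : 0 < √(1 + w ^ 2) * cosh s := by positivity
      rw [← ENNReal.ofReal_mul this.le, mul_one_div_cancel this.ne', ENNReal.ofReal_one]
    calc _ = ENNReal.ofReal (w ^ (2 * lam - 1)) * ((ENNReal.ofReal (√(1 + w ^ 2) * cosh s) *
          ENNReal.ofReal (1 / (√(1 + w ^ 2) * cosh s))) *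
            H (√(1 + w ^ 2) * cosh s) (√(1 + w ^ 2) * sinh s)) := by ring
      _ = _ := by rw [h4, one_mul]
  simp only [← hR]
  rw [lintegral_polar_upper Φ hΦm, lintegral_Ioi_comp_sinh, lintegral_gegenbauerMeasure]
  refine setLIntegral_congr_fun measurableSet_Ioi fun x hx => ?_
  have hx' : 0 < sinh x := sinh_pos_iff.2 hx
  rw [lintegral_angularMeasure, ← lintegral_const_mul' _ _ (by simp),
    ← lintegral_const_mul' _ _ (by simp)]
  refine setLIntegral_congr_fun measurableSet_Ioo fun θ hθ => ?_
  have hs : 0 < sin θ := sin_pos_of_mem_Ioo hθ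
  have h1 : √(1 + (sinh x * cos θ) ^ 2 + (sinh x * sin θ) ^ 2) = cosh x := by
    rw [sqrt_eq_iff_mul_self_eq (by positivity) (by positivity)]
    have := cosh_sq x
    have h3 := sin_sq_add_cos_sq θ
    linear_combination sinh x ^ 2 * h3 - this
  simp only [hΦ, h1]
  rw [← mul_assoc, ← mul_assoc, ← mul_assoc, ← mul_assoc]
  congr 1
  rw [← ENNReal.ofReal_mul (by positivity), ← ENNReal.ofReal_mul (by positivity),
    ← ENNReal.ofReal_mul (by positivity), ← ENNReal.ofReal_mul (by positivity)]
  congr 1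
  rw [mul_rpow hx'.le hs.le, show 2 * lam = 1 + (2 * lam - 1) by ring, rpow_add hx', rpow_one]
  have : cosh x ≠ 0 := (cosh_pos x).ne'
  field_simp
  ring_nf

/-- The generalized shift is self-adjoint: the triangle with sides `x`, `t` may be read from either
end of the side `t`. -/
lemma lintegral_coshSide_symm (lam t : ℝ) (F G : ℝ → ℝ≥0∞) (hF : Measurable F)
    (hG : Measurable G) :
    ∫⁻ x, ∫⁻ φ, F (cosh x) * G (coshSide x t φ) ∂(angularMeasure lam) ∂(gegenbauerMeasure lam)
      = ∫⁻ x, ∫⁻ φ, F (coshSide x t φ) * G (cosh x)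
          ∂(angularMeasure lam) ∂(gegenbauerMeasure lam) := by
  have h1 := lintegral_hyperboloid lam (fun X Y => F X * G (cosh t * X - sinh t * Y))
    ((hF.comp measurable_fst).mul (hG.comp (by fun_prop)))
  have h2 := lintegral_hyperboloid lam (fun X Y => F (cosh t * X - sinh t * Y) * G X)
    ((hF.comp (by fun_prop)).mul (hG.comp measurable_fst))
  have e : ∀ x φ, coshSide x t φ = cosh t * cosh x - sinh t * (sinh x * cos φ) := by
    intro x φ; unfold coshSide; ring
  simp only [e]
  rw [h1, h2]
  refine setLIntegral_congr_fun measurableSet_Ioi fun w _ => ?_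
  have e2 : ∀ s, cosh t * (√(1 + w ^ 2) * cosh s) - sinh t * (√(1 + w ^ 2) * sinh s)
      = √(1 + w ^ 2) * cosh (t - s) := by
    intro s; rw [cosh_sub]; ring
  simp only [e2]
  rw [← lintegral_sub_left_eq_self _ t]
  simp

lemma lintegral_coshSide (lam t : ℝ) (G : ℝ → ℝ≥0∞) (hG : Measurable G) :
    ∫⁻ x, ∫⁻ φ, G (coshSide x t φ) ∂(angularMeasure lam) ∂(gegenbauerMeasure lam)
      = angularMeasure lam univ * ∫⁻ x, G (cosh x) ∂(gegenbauerMeasure lam) := by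
  have h := lintegral_coshSide_symm lam t (fun _ => 1) G measurable_const hG
  simp only [one_mul, lintegral_const] at h
  rw [h, lintegral_mul_const _ (by fun_prop), mul_comm]

lemma coshSide_comm (x t φ : ℝ) : coshSide x t φ = coshSide t x φ := by
  unfold coshSide; ring

lemma one_le_coshSide {x t : ℝ} (hx : 0 ≤ x) (ht : 0 ≤ t) (φ : ℝ) : 1 ≤ coshSide x t φ := by
  have h1 : 1 ≤ cosh (x - t) := one_le_cosh _
  rw [cosh_sub] at h1
  have h2 : sinh x * sinh t * cos φ ≤ sinh x * sinh t * 1 :=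
    mul_le_mul_of_nonneg_left (cos_le_one φ)
      (mul_nonneg (sinh_nonneg_iff.2 hx) (sinh_nonneg_iff.2 ht))
  unfold coshSide
  linarith

/-! ### Powers and the total angular mass -/

lemma lintegral_Ioc_rpow {e ρ : ℝ} (he : -1 < e) (hρ : 0 ≤ ρ) :
    ∫⁻ v in Ioc 0 ρ, ENNReal.ofReal (v ^ e) = ENNReal.ofReal (ρ ^ (e + 1) / (e + 1)) := by
  have hi : IntervalIntegrable (fun v : ℝ => v ^ e) volume 0 ρ :=
    intervalIntegral.intervalIntegrable_rpow' he
  rw [← ofReal_integral_eq_lintegral_ofReal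
    ((intervalIntegrable_iff_integrableOn_Ioc_of_le hρ).1 hi)]
  · rw [← intervalIntegral.integral_of_le hρ, integral_rpow (Or.inl he),
      zero_rpow (by linarith), sub_zero]
  · filter_upwards [ae_restrict_mem measurableSet_Ioc] with v hv
    exact rpow_nonneg hv.1.le _

lemma lintegral_Ioi_rpow {e ρ : ℝ} (he : e < -1) (hρ : 0 < ρ) :
    ∫⁻ v in Ioi ρ, ENNReal.ofReal (v ^ e) = ENNReal.ofReal (-ρ ^ (e + 1) / (e + 1)) := by
  rw [← ofReal_integral_eq_lintegral_ofReal (integrableOn_Ioi_rpow_of_lt he hρ)]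
  · rw [integral_Ioi_rpow_of_lt he hρ]
  · filter_upwards [ae_restrict_mem measurableSet_Ioi] with v hv
    exact rpow_nonneg (hρ.trans hv).le _

/-- A bound for powers of `x` that does not depend on the sign of the exponent. -/
lemma rpow_le_rpow_add_rpow {s x A B : ℝ} (hx1 : x ≤ 1) (hA : 0 < A) (hB : 0 < B)
    (hx : min A B ≤ x) : x ^ s ≤ 1 + (A ^ s + B ^ s) := by
  have hA' : 0 ≤ A ^ s := rpow_nonneg hA.le _
  have hB' : 0 ≤ B ^ s := rpow_nonneg hB.le _
  have hx0 : 0 < x := (lt_min hA hB).trans_le hx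
  rcases le_or_gt 0 s with hs | hs
  · have : x ^ s ≤ 1 := rpow_le_one hx0.le hx1 hs
    linarith
  · rcases min_le_iff.1 hx with h | h
    · have := rpow_le_rpow_of_nonpos hA h hs.le
      linarith
    · have := rpow_le_rpow_of_nonpos hB h hs.le
      linarith

lemma angularMeasure_univ_lt_top {lam : ℝ} (hlam : 0 < lam) : angularMeasure lam univ < ∞ := by
  have h := lintegral_angularMeasure lam (fun _ => 1)
  simp only [lintegral_const, one_mul, mul_one] at h
  rw [h]
  have hs : -1 < 2 * lam - 1 := by linarith
  have h1 : IntervalIntegrable (fun v : ℝ => v ^ (2 * lam - 1)) volume 0 2 :=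
    intervalIntegral.intervalIntegrable_rpow' hs
  have h2 : IntervalIntegrable (fun v : ℝ => (2 / π * v) ^ (2 * lam - 1)) volume 0 π := by
    have := h1.comp_mul_left (c := 2 / π)
    simpa [div_div_eq_mul_div] using this
  have h3 : IntervalIntegrable (fun v : ℝ => (2 / π * (π - v)) ^ (2 * lam - 1)) volume 0 π := by
    have := (h2.comp_sub_left π).symm
    simpa using this
  have h4 : IntegrableOn (fun v : ℝ => 1 + ((2 / π * v) ^ (2 * lam - 1)
      + (2 / π * (π - v)) ^ (2 * lam - 1))) (Ioo 0 π) := by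
    have : IntervalIntegrable (fun v : ℝ => 1 + ((2 / π * v) ^ (2 * lam - 1)
      + (2 / π * (π - v)) ^ (2 * lam - 1))) volume 0 π :=
      intervalIntegrable_const.add (h2.add h3)
    exact ((intervalIntegrable_iff_integrableOn_Ioc_of_le pi_pos.le).1 this).mono_set
      Ioo_subset_Ioc_self
  refine lt_of_le_of_lt ?_ h4.lintegral_lt_top
  refine setLIntegral_mono' measurableSet_Ioo fun φ hφ => ENNReal.ofReal_le_ofReal ?_
  have hπ := pi_pos
  refine rpow_le_rpow_add_rpow (sin_le_one φ) (mul_pos (by positivity) hφ.1)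
    (mul_pos (by positivity) (sub_pos.2 hφ.2)) ?_
  rcases le_total φ (π / 2) with h | h
  · exact (min_le_left _ _).trans (mul_le_sin hφ.1.le h)
  · rw [← sin_pi_sub]
    exact (min_le_right _ _).trans (mul_le_sin (sub_pos.2 hφ.2).le (by linarith))

/-! ### Generalized convolution -/

/-- The generalized convolution `∫ (∫ k(ch x ch t - sh x sh t cos φ) dν(φ)) f(t) dμ(t)` of
nonnegative functions; `k` is a function of the hyperbolic cosine, `f` of the radius itself, and the
shift is not normalized. -/
def shiftConv (lam : ℝ) (k f : ℝ → ℝ≥0∞) (x : ℝ) : ℝ≥0∞ :=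
  ∫⁻ t, ∫⁻ φ, k (coshSide x t φ) * f t ∂(angularMeasure lam) ∂(gegenbauerMeasure lam)

section shiftConv

variable {lam : ℝ} {k f : ℝ → ℝ≥0∞}

lemma measurable_shiftConv_inner (lam : ℝ) (hk : Measurable k) (hf : Measurable f) :
    Measurable (fun p : ℝ × ℝ => ∫⁻ φ, k (coshSide p.1 p.2 φ) * f p.2 ∂(angularMeasure lam)) := by
  apply Measurable.lintegral_prod_right'
    (f := fun q : (ℝ × ℝ) × ℝ => k (coshSide q.1.1 q.1.2 q.2) * f q.1.2)
  refine (hk.comp ?_).mul (hf.comp (by fun_prop))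
  unfold coshSide; fun_prop

lemma measurable_kernel_right (hk : Measurable k) (x t : ℝ) :
    Measurable (fun φ => k (coshSide x t φ)) := by
  refine hk.comp ?_
  unfold coshSide; fun_prop

lemma measurable_kernel_prod (hk : Measurable k) (x : ℝ) :
    Measurable (fun p : ℝ × ℝ => k (coshSide x p.1 p.2)) := by
  refine hk.comp ?_
  unfold coshSide; fun_prop

lemma measurable_shiftConv_slice (hk : Measurable k) (hf : Measurable f) (x : ℝ) :
    Measurable (fun t => ∫⁻ φ, k (coshSide x t φ) * f t ∂(angularMeasure lam)) :=
  ((measurable_kernel_prod hk x).mul (hf.comp measurable_fst)).lintegral_prod_right'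

lemma measurable_shiftConv (lam : ℝ) (hk : Measurable k) (hf : Measurable f) :
    Measurable (shiftConv lam k f) :=
  (measurable_shiftConv_inner lam hk hf).lintegral_prod_right'

lemma lintegral_kernel (hk : Measurable k) (x : ℝ) :
    ∫⁻ t, ∫⁻ φ, k (coshSide x t φ) ∂(angularMeasure lam) ∂(gegenbauerMeasure lam)
      = angularMeasure lam univ * ∫⁻ u, k (cosh u) ∂(gegenbauerMeasure lam) := by
  simp_rw [coshSide_comm x]
  exact lintegral_coshSide lam x k hk

lemma shiftConv_le_of_le (hk : Measurable k) {a : ℝ≥0∞} (hfa : ∀ t, f t ≤ a) (x : ℝ) :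
    shiftConv lam k f x
      ≤ angularMeasure lam univ * (∫⁻ u, k (cosh u) ∂(gegenbauerMeasure lam)) * a := by
  calc shiftConv lam k f x
      ≤ ∫⁻ t, ∫⁻ φ, k (coshSide x t φ) * a ∂(angularMeasure lam) ∂(gegenbauerMeasure lam) :=
        lintegral_mono fun t => lintegral_mono fun φ => by gcongr; exact hfa t
    _ = _ := by
        rw [← lintegral_kernel hk x, ← lintegral_mul_const]
        · congr 1 with t
          rw [lintegral_mul_const _ (measurable_kernel_right hk x t)]
        · exact (measurable_kernel_prod hk x).lintegral_prod_right'

lemma lintegral_shiftConv (hk : Measurable k) (hf : Measurable f) :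
    ∫⁻ x, shiftConv lam k f x ∂(gegenbauerMeasure lam)
      = angularMeasure lam univ * (∫⁻ u, k (cosh u) ∂(gegenbauerMeasure lam)) *
          ∫⁻ t, f t ∂(gegenbauerMeasure lam) := by
  unfold shiftConv
  rw [lintegral_lintegral_swap (measurable_shiftConv_inner lam hk hf).aemeasurable,
    ← lintegral_const_mul _ hf]
  congr 1 with t
  rw [← lintegral_coshSide lam t k hk, ← lintegral_mul_const]
  · congr 1 with x
    rw [lintegral_mul_const _ (measurable_kernel_right hk x t)]
  · simp_rw [coshSide_comm _ t]
    exact (measurable_kernel_prod hk t).lintegral_prod_right'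

lemma shiftConv_eq_lintegral_prod (hk : Measurable k) (hf : Measurable f) (x : ℝ) :
    shiftConv lam k f x = ∫⁻ p, k (coshSide x p.1 p.2) * f p.1
      ∂((gegenbauerMeasure lam).prod (angularMeasure lam)) := by
  rw [lintegral_prod (fun p : ℝ × ℝ => k (coshSide x p.1 p.2) * f p.1)
    ((measurable_kernel_prod hk x).mul (hf.comp measurable_fst)).aemeasurable]
  rfl

lemma shiftConv_le_holder (hk : Measurable k) (hf : Measurable f) {p p' : ℝ}
    (hpp : p'.HolderConjugate p) (x : ℝ) :
    shiftConv lam k f x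
      ≤ (angularMeasure lam univ * ∫⁻ u, k (cosh u) ^ p' ∂(gegenbauerMeasure lam)) ^ (1 / p') *
        (angularMeasure lam univ * ∫⁻ t, f t ^ p ∂(gegenbauerMeasure lam)) ^ (1 / p) := by
  rw [shiftConv_eq_lintegral_prod hk hf]
  refine (ENNReal.lintegral_mul_le_Lp_mul_Lq _ hpp (measurable_kernel_prod hk x).aemeasurable
    (hf.comp measurable_fst).aemeasurable).trans_eq ?_
  congr 2
  · rw [lintegral_prod _ ((measurable_kernel_prod hk x).pow_const _).aemeasurable]
    exact lintegral_kernel (k := fun z => k z ^ p') (hk.pow_const p') x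
  · rw [lintegral_prod _ ((hf.comp measurable_fst).pow_const _).aemeasurable]
    simp only [Function.comp_apply, lintegral_const]
    rw [lintegral_mul_const _ (by fun_prop), mul_comm]

lemma shiftConv_add_left (hk : Measurable k) (hf : Measurable f) (k' : ℝ → ℝ≥0∞) (x : ℝ) :
    shiftConv lam (fun z => k z + k' z) f x = shiftConv lam k f x + shiftConv lam k' f x := by
  unfold shiftConv
  rw [← lintegral_add_left (measurable_shiftConv_slice hk hf x)]
  congr 1 with t
  rw [← lintegral_add_left ((measurable_kernel_right hk x t).mul_const _)]
  congr 1 with φ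
  ring

lemma shiftConv_add_right (hk : Measurable k) (hf : Measurable f) (f' : ℝ → ℝ≥0∞) (x : ℝ) :
    shiftConv lam k (fun t => f t + f' t) x = shiftConv lam k f x + shiftConv lam k f' x := by
  unfold shiftConv
  rw [← lintegral_add_left (measurable_shiftConv_slice hk hf x)]
  congr 1 with t
  rw [← lintegral_add_left ((measurable_kernel_right hk x t).mul_const _)]
  congr 1 with φ
  ring

lemma shiftConv_const_mul (hk : Measurable k) (hf : Measurable f) (c : ℝ≥0∞) (x : ℝ) :
    shiftConv lam k (fun t => c * f t) x = c * shiftConv lam k f x := by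
  unfold shiftConv
  rw [← lintegral_const_mul _
    (measurable_shiftConv_slice hk hf x)]
  congr 1 with t
  rw [← lintegral_const_mul _ ((measurable_kernel_right hk x t).mul_const _)]
  congr 1 with φ
  ring

end shiftConv

/-! ### The two parts of the Riesz kernel -/

lemma rieszKernel_cosh (lam α : ℝ) {u : ℝ} (hu : 0 ≤ u) :
    rieszKernel lam α (cosh u) = sinh u ^ (α - 2 * lam - 1) := by
  rw [rieszKernel, ← sinh_sq, sqrt_sq (sinh_nonneg_iff.2 hu)]

lemma rieszKernel_nonneg (lam α y : ℝ) : 0 ≤ rieszKernel lam α y := rpow_nonneg (sqrt_nonneg _) _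

@[fun_prop]
lemma measurable_rieszKernel (lam α : ℝ) : Measurable (rieszKernel lam α) := by
  unfold rieszKernel; fun_prop

/-- The Riesz kernel restricted to `sh u ≤ ρ`. -/
def nearKernel (lam α ρ z : ℝ) : ℝ≥0∞ :=
  if √(z ^ 2 - 1) ≤ ρ then ENNReal.ofReal (rieszKernel lam α z) else 0

/-- The Riesz kernel restricted to `sh u > ρ`. -/
def farKernel (lam α ρ z : ℝ) : ℝ≥0∞ :=
  if √(z ^ 2 - 1) ≤ ρ then 0 else ENNReal.ofReal (rieszKernel lam α z)

lemma measurable_nearKernel (lam α ρ : ℝ) : Measurable (nearKernel lam α ρ) :=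
  Measurable.ite (measurableSet_le (by fun_prop) measurable_const) (by fun_prop) measurable_const

lemma measurable_farKernel (lam α ρ : ℝ) : Measurable (farKernel lam α ρ) :=
  Measurable.ite (measurableSet_le (by fun_prop) measurable_const) measurable_const (by fun_prop)

lemma nearKernel_add_farKernel (lam α ρ z : ℝ) :
    nearKernel lam α ρ z + farKernel lam α ρ z = ENNReal.ofReal (rieszKernel lam α z) := by
  unfold nearKernel farKernel
  split_ifs <;> simp

/-- Since `ch ≥ 1`, the measure is dominated, in the variable `v = sh u`, by `v^{2λ} dv`. -/
lemma lintegral_comp_sinh_le (lam : ℝ) (g : ℝ → ℝ≥0∞) :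
    ∫⁻ u, g (sinh u) ∂(gegenbauerMeasure lam)
      ≤ ∫⁻ v in Ioi 0, ENNReal.ofReal (v ^ (2 * lam)) * g v := by
  rw [lintegral_gegenbauerMeasure, lintegral_Ioi_comp_sinh fun v => _ * g v]
  refine setLIntegral_mono' measurableSet_Ioi fun u _ => ?_
  refine le_mul_of_one_le_left zero_le ?_
  exact ENNReal.one_le_ofReal.2 (one_le_cosh u)

lemma lintegral_nearKernel_le (lam : ℝ) {α ρ : ℝ} (hα : 0 < α) (hρ : 0 ≤ ρ) :
    ∫⁻ u, nearKernel lam α ρ (cosh u) ∂(gegenbauerMeasure lam) ≤ ENNReal.ofReal (ρ ^ α / α) := by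
  have h1 : ∫⁻ u, nearKernel lam α ρ (cosh u) ∂(gegenbauerMeasure lam)
      = ∫⁻ u, (fun v => (Iic ρ).indicator (fun v => ENNReal.ofReal (v ^ (α - 2 * lam - 1))) v)
          (sinh u) ∂(gegenbauerMeasure lam) := by
    refine lintegral_congr_ae ?_
    filter_upwards [ae_gegenbauerMeasure_pos lam] with u hu
    rw [nearKernel, rieszKernel_cosh lam α hu.le, ← sinh_sq, sqrt_sq (sinh_nonneg_iff.2 hu.le)]
    simp [indicator]
  rw [h1]
  refine (lintegral_comp_sinh_le lam _).trans_eq ?_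
  have h2 := lintegral_Ioc_rpow (e := α - 1) (ρ := ρ) (by linarith) hρ
  rw [sub_add_cancel] at h2
  rw [← h2, ← Ioi_inter_Iic, inter_comm, ← Measure.restrict_restrict measurableSet_Iic,
    ← lintegral_indicator measurableSet_Iic]
  refine setLIntegral_congr_fun measurableSet_Ioi fun v hv => ?_
  by_cases h : v ≤ ρ
  · simp only [indicator, mem_Iic, h, if_true]
    rw [← ENNReal.ofReal_mul (rpow_nonneg (le_of_lt hv) _), ← rpow_add hv]
    ring_nf
  · simp [indicator, h]

lemma lintegral_farKernel_rpow_le (lam α : ℝ) {s ρ : ℝ} (hs : 0 < s)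
    (he : (2 * lam + 1) + (α - (2 * lam + 1)) * s < 0) (hρ : 0 < ρ) :
    ∫⁻ u, farKernel lam α ρ (cosh u) ^ s ∂(gegenbauerMeasure lam)
      ≤ ENNReal.ofReal (ρ ^ ((2 * lam + 1) + (α - (2 * lam + 1)) * s) /
          (-((2 * lam + 1) + (α - (2 * lam + 1)) * s))) := by
  have h1 : ∫⁻ u, farKernel lam α ρ (cosh u) ^ s ∂(gegenbauerMeasure lam)
      = ∫⁻ u, (fun v => (Ioi ρ).indicator
          (fun v => ENNReal.ofReal (v ^ (α - 2 * lam - 1)) ^ s) v)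
          (sinh u) ∂(gegenbauerMeasure lam) := by
    refine lintegral_congr_ae ?_
    filter_upwards [ae_gegenbauerMeasure_pos lam] with u hu
    rw [farKernel, rieszKernel_cosh lam α hu.le, ← sinh_sq, sqrt_sq (sinh_nonneg_iff.2 hu.le)]
    by_cases h : sinh u ≤ ρ
    · simp [indicator, h, not_lt.2 h, hs]
    · simp [indicator, h, not_le.1 h]
  rw [h1]
  refine (lintegral_comp_sinh_le lam _).trans_eq ?_
  have h2 := lintegral_Ioi_rpow (e := 2 * lam + (α - 2 * lam - 1) * s) (ρ := ρ) (by linarith) hρ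
  rw [show 2 * lam + (α - 2 * lam - 1) * s + 1 = (2 * lam + 1) + (α - (2 * lam + 1)) * s by ring,
    neg_div, ← div_neg] at h2
  rw [← h2]
  have h3 : volume.restrict (Ioi ρ) = (volume.restrict (Ioi (0 : ℝ))).restrict (Ioi ρ) := by
    rw [Measure.restrict_restrict measurableSet_Ioi, inter_eq_left.2 (Ioi_subset_Ioi hρ.le)]
  rw [h3, ← lintegral_indicator (measurableSet_Ioi (a := ρ))]
  refine setLIntegral_congr_fun measurableSet_Ioi fun v hv => ?_
  have hv' : (0:ℝ) < v := hv
  by_cases h : ρ < v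
  · simp only [indicator, mem_Ioi, h, if_true]
    rw [ENNReal.ofReal_rpow_of_pos (rpow_pos_of_pos hv' _), ← rpow_mul hv'.le,
      ← ENNReal.ofReal_mul (rpow_nonneg hv'.le _), ← rpow_add hv']
  · simp [indicator, h]

lemma farKernel_cosh_le (lam : ℝ) {α ρ : ℝ} (hα : α < 2 * lam + 1) (hρ : 0 < ρ) (z : ℝ) :
    farKernel lam α ρ z ≤ ENNReal.ofReal (ρ ^ (α - 2 * lam - 1)) := by
  unfold farKernel
  split_ifs with h
  · exact zero_le
  · exact ENNReal.ofReal_le_ofReal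
      (rpow_le_rpow_of_nonpos hρ (not_le.1 h).le (by linarith))

/-! ### Strong and weak type estimates -/

lemma lintegral_Ioi_indicator_lt {e y : ℝ} (he : -1 < e) (hy : 0 ≤ y) :
    ∫⁻ β in Ioi 0, (if β < y then ENNReal.ofReal (β ^ e) else 0)
      = ENNReal.ofReal (y ^ (e + 1) / (e + 1)) := by
  rw [← lintegral_Ioc_rpow he hy, ← restrict_Ioo_eq_restrict_Ioc, ← Ioi_inter_Iio, inter_comm,
    ← Measure.restrict_restrict measurableSet_Iio,
    ← lintegral_indicator (measurableSet_Iio (a := y))]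
  rfl

/-- The layer-cake formula for powers, for functions that may take the value `∞`. -/
lemma rpow_le_lintegral_layer {q : ℝ} (hq : 0 < q) (g : ℝ≥0∞) :
    g ^ q ≤ ∫⁻ β in Ioi 0, (if ENNReal.ofReal β < g then ENNReal.ofReal (q * β ^ (q - 1)) else 0)
    := by
  have key : ∀ y : ℝ, 0 ≤ y → ENNReal.ofReal y ≤ g → ENNReal.ofReal y ^ q ≤
      ∫⁻ β in Ioi 0, (if ENNReal.ofReal β < g then ENNReal.ofReal (q * β ^ (q - 1)) else 0) := by
    intro y hy hyg
    have h := lintegral_Ioi_indicator_lt (e := q - 1) (by linarith) hy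
    rw [sub_add_cancel] at h
    calc ENNReal.ofReal y ^ q = ENNReal.ofReal q * ENNReal.ofReal (y ^ q / q) := by
          rw [ENNReal.ofReal_rpow_of_nonneg hy hq.le, ← ENNReal.ofReal_mul hq.le]
          congr 1; field_simp
      _ = ∫⁻ β in Ioi 0, ENNReal.ofReal q *
            (if β < y then ENNReal.ofReal (β ^ (q - 1)) else 0) := by
          rw [← h, lintegral_const_mul' _ _ (by simp)]
      _ ≤ _ := by
          refine setLIntegral_mono' measurableSet_Ioi fun β hβ => ?_
          have hβ' : (0 : ℝ) < β := hβ
          split_ifs with h1 h2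
          · rw [ENNReal.ofReal_mul hq.le]
          · exact absurd (((ENNReal.ofReal_lt_ofReal_iff_of_nonneg hβ'.le).2 h1).trans_le hyg) h2
          · simp
          · simp
  by_cases hg : g = ∞
  · have hall : ∀ y : ℝ, 0 ≤ y → ENNReal.ofReal y ≤ ∫⁻ β in Ioi 0,
        (if ENNReal.ofReal β < g then ENNReal.ofReal (q * β ^ (q - 1)) else 0) := by
      intro y hy
      have := key (y ^ q⁻¹) (rpow_nonneg hy _) (by simp [hg])
      rwa [ENNReal.ofReal_rpow_of_nonneg (rpow_nonneg hy _) hq.le, rpow_inv_rpow hy hq.ne']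
        at this
    have : ∫⁻ β in Ioi 0,
        (if ENNReal.ofReal β < g then ENNReal.ofReal (q * β ^ (q - 1)) else 0) = ∞ := by
      refine ENNReal.eq_top_of_forall_nnreal_le fun r => ?_
      simpa using hall r r.2
    rw [this]; exact le_top
  · have := key g.toReal ENNReal.toReal_nonneg (by rw [ENNReal.ofReal_toReal hg])
    rwa [ENNReal.ofReal_toReal hg] at this

/-- If the distribution function of `G` at height `β` is controlled by the part of `f` above the
height `c β^{q/p}`, then `G ∈ L^q` as soon as `f ∈ L^p`. -/
lemma lintegral_rpow_le_of_level_estimate {μ : Measure ℝ} [SFinite μ] {f G : ℝ → ℝ≥0∞}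
    (hf : Measurable f) (hG : Measurable G) (hfin : ∀ t, f t ≠ ∞) {p q c : ℝ} (hp : 1 < p)
    (hq : 0 < q) (hc : 0 < c)
    (hlev : ∀ β : ℝ, 0 < β → μ {x | ENNReal.ofReal β < G x} ≤
      ENNReal.ofReal ((c * β ^ (q / p))⁻¹) *
        ∫⁻ t, (if ENNReal.ofReal (c * β ^ (q / p)) < f t then f t else 0) ∂μ) :
    ∫⁻ x, G x ^ q ∂μ ≤
      ENNReal.ofReal (q / c * (c⁻¹ ^ (p - 1) / (q - q / p))) * ∫⁻ t, f t ^ p ∂μ := by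
  have hp0 : 0 < p := by linarith
  have hqp : 0 < q - q / p := by
    have : q / p < q := div_lt_self hq hp
    linarith
  have hmeas1 : Measurable (fun z : ℝ × ℝ =>
      if ENNReal.ofReal z.2 < G z.1 then ENNReal.ofReal (q * z.2 ^ (q - 1)) else 0) :=
    Measurable.ite (measurableSet_lt (by fun_prop) (hG.comp measurable_fst)) (by fun_prop)
      measurable_const
  have hmeas2 : Measurable (fun z : ℝ × ℝ => ENNReal.ofReal (q / c * z.1 ^ (q - 1 - q / p)) *
      (if ENNReal.ofReal (c * z.1 ^ (q / p)) < f z.2 then f z.2 else 0)) :=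
    Measurable.mul (by fun_prop)
      (Measurable.ite (measurableSet_lt (by fun_prop) (hf.comp measurable_snd))
        (hf.comp measurable_snd) measurable_const)
  calc ∫⁻ x, G x ^ q ∂μ
      ≤ ∫⁻ x, (∫⁻ β in Ioi 0,
          (if ENNReal.ofReal β < G x then ENNReal.ofReal (q * β ^ (q - 1)) else 0)) ∂μ :=
        lintegral_mono fun x => rpow_le_lintegral_layer hq _
    _ = ∫⁻ β in Ioi 0, ∫⁻ x,
          (if ENNReal.ofReal β < G x then ENNReal.ofReal (q * β ^ (q - 1)) else 0) ∂μ :=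
        lintegral_lintegral_swap hmeas1.aemeasurable
    _ ≤ ∫⁻ β in Ioi 0, ∫⁻ t, ENNReal.ofReal (q / c * β ^ (q - 1 - q / p)) *
          (if ENNReal.ofReal (c * β ^ (q / p)) < f t then f t else 0) ∂μ := by
        refine setLIntegral_mono' measurableSet_Ioi fun β hβ => ?_
        have hβ' : (0 : ℝ) < β := hβ
        have e1 : ∫⁻ x, (if ENNReal.ofReal β < G x then ENNReal.ofReal (q * β ^ (q - 1)) else 0) ∂μ
            = ENNReal.ofReal (q * β ^ (q - 1)) * μ {x | ENNReal.ofReal β < G x} := by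
          rw [← lintegral_indicator_const (measurableSet_lt measurable_const hG)]
          simp only [indicator, mem_ofPred_eq]
        rw [e1, lintegral_const_mul' _ _ (by simp)]
        refine (mul_le_mul_right (hlev β hβ') _).trans_eq ?_
        rw [← mul_assoc, ← ENNReal.ofReal_mul (by positivity)]
        congr 2
        rw [rpow_sub hβ' (q - 1) (q / p)]
        field_simp
    _ = ∫⁻ t, (∫⁻ β in Ioi 0, ENNReal.ofReal (q / c * β ^ (q - 1 - q / p)) *
          (if ENNReal.ofReal (c * β ^ (q / p)) < f t then f t else 0)) ∂μ :=
        lintegral_lintegral_swap hmeas2.aemeasurable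
    _ = ∫⁻ t, ENNReal.ofReal (q / c * (c⁻¹ ^ (p - 1) / (q - q / p))) * f t ^ p ∂μ := by
        congr 1 with t
        obtain ⟨y, hy, hyf⟩ : ∃ y : ℝ, 0 ≤ y ∧ f t = ENNReal.ofReal y :=
          ⟨(f t).toReal, ENNReal.toReal_nonneg, (ENNReal.ofReal_toReal (hfin t)).symm⟩
        rw [hyf]
        have hcond : ∀ β : ℝ, 0 < β →
            (ENNReal.ofReal (c * β ^ (q / p)) < ENNReal.ofReal y ↔ β < (y / c) ^ (p / q)) := by
          intro β hβ
          rw [ENNReal.ofReal_lt_ofReal_iff_of_nonneg (by positivity), ← lt_div_iff₀' hc,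
            ← rpow_lt_rpow_iff (z := p / q) (by positivity) (by positivity) (by positivity),
            ← rpow_mul hβ.le]
          rw [show q / p * (p / q) = 1 by field_simp, rpow_one]
        have e2 : ∫⁻ β in Ioi 0, ENNReal.ofReal (q / c * β ^ (q - 1 - q / p)) *
            (if ENNReal.ofReal (c * β ^ (q / p)) < ENNReal.ofReal y then ENNReal.ofReal y else 0)
            = ∫⁻ β in Ioi 0, ENNReal.ofReal (q / c * y) *
              (if β < (y / c) ^ (p / q) then ENNReal.ofReal (β ^ (q - 1 - q / p)) else 0) := by
          refine setLIntegral_congr_fun measurableSet_Ioi fun β hβ => ?_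
          have hβ' : (0 : ℝ) < β := hβ
          simp only [hcond β hβ']
          split_ifs with h
          · rw [← ENNReal.ofReal_mul (by positivity), ← ENNReal.ofReal_mul (by positivity)]
            ring_nf
          · simp
        rw [e2, lintegral_const_mul' _ _ (by simp),
          lintegral_Ioi_indicator_lt (by linarith) (by positivity),
          ENNReal.ofReal_rpow_of_nonneg hy hp0.le, ← ENNReal.ofReal_mul (by positivity),
          ← ENNReal.ofReal_mul (by positivity), ← rpow_mul (by positivity)]
        congr 1
        rw [show p / q * (q - 1 - q / p + 1) = p - 1 by field_simp; ring,
          show q - 1 - q / p + 1 = q - q / p by ring, div_eq_mul_inv y c,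
          mul_rpow hy (by positivity)]
        rcases hy.eq_or_lt with h0 | h0
        · simp [← h0, zero_rpow hp0.ne']
        · rw [show y ^ p = y * y ^ (p - 1) by rw [rpow_sub_one h0.ne']; field_simp]
          ring
    _ = _ := lintegral_const_mul' _ _ (by simp)

section operator

variable {lam α p q : ℝ}

/-- The kernel of the fractional integral, as a function of the hyperbolic cosine. -/
def rieszKernelENN (lam α z : ℝ) : ℝ≥0∞ := ENNReal.ofReal (rieszKernel lam α z)

lemma measurable_rieszKernelENN (lam α : ℝ) : Measurable (rieszKernelENN lam α) := by
  unfold rieszKernelENN; fun_prop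

lemma shiftConv_split {f : ℝ → ℝ≥0∞} (hf : Measurable f) (ρ x : ℝ) :
    shiftConv lam (rieszKernelENN lam α) f x
      = shiftConv lam (nearKernel lam α ρ) f x + shiftConv lam (farKernel lam α ρ) f x := by
  rw [← shiftConv_add_left (measurable_nearKernel lam α ρ) hf]
  simp only [nearKernel_add_farKernel]
  rfl

lemma shiftConv_near_le (hα : 0 < α) {ρ : ℝ} (hρ : 0 ≤ ρ) {f : ℝ → ℝ≥0∞} {a : ℝ≥0∞}
    (hfa : ∀ t, f t ≤ a) (x : ℝ) :
    shiftConv lam (nearKernel lam α ρ) f x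
      ≤ angularMeasure lam univ * ENNReal.ofReal (ρ ^ α / α) * a := by
  refine (shiftConv_le_of_le (measurable_nearKernel lam α ρ) hfa x).trans ?_
  gcongr
  exact lintegral_nearKernel_le lam hα hρ

lemma lintegral_shiftConv_near_le (hα : 0 < α) {ρ : ℝ} (hρ : 0 ≤ ρ) {f : ℝ → ℝ≥0∞}
    (hf : Measurable f) :
    ∫⁻ x, shiftConv lam (nearKernel lam α ρ) f x ∂(gegenbauerMeasure lam)
      ≤ angularMeasure lam univ * ENNReal.ofReal (ρ ^ α / α) *
        ∫⁻ t, f t ∂(gegenbauerMeasure lam) := by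
  rw [lintegral_shiftConv (measurable_nearKernel lam α ρ) hf]
  gcongr
  exact lintegral_nearKernel_le lam hα hρ

lemma shiftConv_far_le_one (hα : α < 2 * lam + 1) {ρ : ℝ} (hρ : 0 < ρ) {f : ℝ → ℝ≥0∞}
    (hf : Measurable f) (x : ℝ) :
    shiftConv lam (farKernel lam α ρ) f x
      ≤ angularMeasure lam univ * ENNReal.ofReal (ρ ^ (α - 2 * lam - 1)) *
        ∫⁻ t, f t ∂(gegenbauerMeasure lam) := by
  calc shiftConv lam (farKernel lam α ρ) f x
      ≤ ∫⁻ t, ∫⁻ φ, ENNReal.ofReal (ρ ^ (α - 2 * lam - 1)) * f t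
          ∂(angularMeasure lam) ∂(gegenbauerMeasure lam) :=
        lintegral_mono fun t => lintegral_mono fun φ => by
          gcongr; exact farKernel_cosh_le lam hα hρ _
    _ = _ := by
        simp only [lintegral_const]
        rw [lintegral_mul_const _ (hf.const_mul _), lintegral_const_mul _ hf]
        ring

/-- The relation between the exponents forces `q` to be positive; in particular `1 / q` is not the
junk value of a division by zero. -/
lemma exponent_pos (hlam : 0 < lam) (hα : 0 < α) (hp : 1 ≤ p) (hp' : p < (2 * lam + 1) / α)
    (hpq : 1 / p - 1 / q = α / (2 * lam + 1)) : 0 < q := by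
  have h1 : α / (2 * lam + 1) < 1 / p := by
    rw [lt_div_iff₀ hα] at hp'
    rw [div_lt_div_iff₀ (by linarith) (by linarith)]
    linarith
  have : 0 < 1 / q := by linarith
  exact one_div_pos.1 this

/-- Hölder's inequality for the far part of the kernel. The power of `ρ` is negative, as in the
Euclidean case, precisely because `p < (2λ+1) / α`. -/
lemma shiftConv_far_le (hlam : 0 < lam) (hα : 0 < α) (hp : 1 < p)
    (hp' : p < (2 * lam + 1) / α) (hpq : 1 / p - 1 / q = α / (2 * lam + 1)) :
    ∃ D : ℝ, 0 < D ∧ ∀ ρ : ℝ, 0 < ρ → ∀ f : ℝ → ℝ≥0∞, Measurable f →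
      ∫⁻ t, f t ^ p ∂(gegenbauerMeasure lam) ≤ 1 → ∀ x,
      shiftConv lam (farKernel lam α ρ) f x ≤ ENNReal.ofReal (D * ρ ^ (-(2 * lam + 1) / q)) := by
  have hq : 0 < q := exponent_pos hlam hα hp.le hp' hpq
  set n := 2 * lam + 1 with hn
  have hn0 : 0 < n := by positivity
  set p' := p / (p - 1) with hp'def
  have hconj : p'.HolderConjugate p := (Real.HolderConjugate.conjExponent hp).symm
  have hp1 : 0 < p - 1 := by linarith
  have hp'0 : 0 < p' := div_pos (by linarith) hp1
  set E := n + (α - n) * p' with hE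
  -- `E / p' = -n / q`, which is the relation between the exponents
  have hEp : E / p' = -n / q := by
    have h2 : 1 / p' = 1 - 1 / p := by rw [hp'def]; field_simp
    have h3 : 1 / q = 1 / p - α / n := by linarith
    calc E / p' = n * (1 / p') + (α - n) := by rw [hE]; field_simp
      _ = -n * (1 / q) := by rw [h2, h3]; field_simp; ring
      _ = -n / q := by ring
  have hEneg : E < 0 := by
    have : E / p' < 0 := by rw [hEp, neg_div]; exact neg_lt_zero.2 (div_pos hn0 hq)
    by_contra h
    exact absurd (div_nonneg (not_lt.1 h) hp'0.le) (not_le.2 this)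
  obtain ⟨m, hm0, hm⟩ : ∃ m : ℝ, 0 ≤ m ∧ angularMeasure lam univ = ENNReal.ofReal m :=
    ⟨_, ENNReal.toReal_nonneg,
      (ENNReal.ofReal_toReal (angularMeasure_univ_lt_top hlam).ne).symm⟩
  refine ⟨(m / -E) ^ (1 / p') * m ^ (1 / p) + 1, ?_, ?_⟩
  · have : 0 ≤ m / -E := div_nonneg hm0 (by linarith)
    positivity
  intro ρ hρ f hf hf1 x
  have hmE : 0 ≤ m / -E := div_nonneg hm0 (by linarith)
  calc shiftConv lam (farKernel lam α ρ) f x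
      ≤ _ := shiftConv_le_holder (measurable_farKernel lam α ρ) hf hconj x
    _ ≤ (ENNReal.ofReal m * ENNReal.ofReal (ρ ^ E / -E)) ^ (1 / p') *
          (ENNReal.ofReal m * 1) ^ (1 / p) := by
        rw [hm]
        gcongr
        exact lintegral_farKernel_rpow_le lam α hp'0 hEneg hρ
    _ = ENNReal.ofReal ((m / -E) ^ (1 / p') * m ^ (1 / p) * ρ ^ (-n / q)) := by
        have hρE : 0 ≤ ρ ^ E / -E := div_nonneg (rpow_nonneg hρ.le _) (by linarith)
        rw [mul_one, ← ENNReal.ofReal_mul hm0,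
          ENNReal.ofReal_rpow_of_nonneg (mul_nonneg hm0 hρE) (by positivity),
          ENNReal.ofReal_rpow_of_nonneg hm0 (by positivity), ← ENNReal.ofReal_mul (by positivity)]
        congr 1
        rw [show m * (ρ ^ E / -E) = m / -E * ρ ^ E by ring,
          mul_rpow hmE (rpow_nonneg hρ.le _), ← rpow_mul hρ.le, mul_one_div, hEp]
        ring
    _ ≤ _ := by
        refine ENNReal.ofReal_le_ofReal ?_
        gcongr
        linarith

/-- The Hardy–Littlewood–Sobolev inequality for generalized convolution with the Riesz kernel, for
normalized functions. -/
lemma shiftConv_strong_type_normalized (hlam : 0 < lam) (hα : 0 < α) (hp : 1 < p)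
    (hp' : p < (2 * lam + 1) / α) (hpq : 1 / p - 1 / q = α / (2 * lam + 1)) :
    ∃ C : ℝ, 0 < C ∧ ∀ f : ℝ → ℝ≥0∞, Measurable f → (∀ t, f t ≠ ∞) →
      ∫⁻ t, f t ^ p ∂(gegenbauerMeasure lam) ≤ 1 →
      ∫⁻ x, shiftConv lam (rieszKernelENN lam α) f x ^ q ∂(gegenbauerMeasure lam)
        ≤ ENNReal.ofReal C := by
  have hq : 0 < q := exponent_pos hlam hα hp.le hp' hpq
  obtain ⟨D₁, hD₁, hfar⟩ := shiftConv_far_le hlam hα hp hp' hpq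
  set n := 2 * lam + 1 with hn
  have hn0 : 0 < n := by positivity
  have hp0 : 0 < p := by linarith
  obtain ⟨m, hm0, hm⟩ : ∃ m : ℝ, 0 ≤ m ∧ angularMeasure lam univ = ENNReal.ofReal m :=
    ⟨_, ENNReal.toReal_nonneg,
      (ENNReal.ofReal_toReal (angularMeasure_univ_lt_top hlam).ne).symm⟩
  set D₂ := (m + 1) / α with hD₂def
  have hD₂ : 0 < D₂ := by positivity
  have hnear : ∀ ρ : ℝ, 0 < ρ → angularMeasure lam univ * ENNReal.ofReal (ρ ^ α / α)
      ≤ ENNReal.ofReal (D₂ * ρ ^ α) := by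
    intro ρ hρ
    rw [hm, ← ENNReal.ofReal_mul hm0]
    refine ENNReal.ofReal_le_ofReal ?_
    have : 0 < ρ ^ α := rpow_pos_of_pos hρ _
    rw [hD₂def, mul_div_assoc', div_mul_eq_mul_div]
    gcongr
    linarith
  set c := (4 * D₂)⁻¹ * (2 * D₁) ^ (-(q * α / n)) with hc
  have hc0 : 0 < c := by positivity
  have hqp : 0 < q - q / p := by
    have : q / p < q := div_lt_self hq hp
    linarith
  refine ⟨q / c * (c⁻¹ ^ (p - 1) / (q - q / p)), by positivity, fun f hf hfin hf1 => ?_⟩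
  refine (lintegral_rpow_le_of_level_estimate (μ := gegenbauerMeasure lam) hf
    (measurable_shiftConv lam (measurable_rieszKernelENN lam α) hf) hfin hp hq hc0
    fun β hβ => ?_).trans (mul_le_of_le_one_right (by simp) hf1)
  -- with this radius, the far part of the kernel contributes at most `β / 2`
  set ρ := (β / (2 * D₁)) ^ (-q / n) with hρdef
  have hρ : 0 < ρ := by positivity
  have hρn : D₁ * ρ ^ (-n / q) = β / 2 := by
    rw [hρdef, ← rpow_mul (by positivity), show -q / n * (-n / q) = 1 by field_simp, rpow_one]
    field_simp
  -- and the part of `f` below the height `a` contributes at most `β / 4` to the near part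
  set a := c * β ^ (q / p) with ha
  have ha0 : 0 < a := by positivity
  have haρ : D₂ * ρ ^ α * a = β / 4 := by
    have h1 : q / p = 1 + q * α / n := by
      have : 1 / p = 1 / q + α / n := by linarith
      calc q / p = q * (1 / p) := by ring
        _ = _ := by rw [this]; field_simp
    rw [ha, hc, hρdef, ← rpow_mul (by positivity), show -q / n * α = -(q * α / n) by ring, h1,
      rpow_add hβ, rpow_one, div_rpow hβ.le (by positivity), rpow_neg hβ.le,
      rpow_neg (by positivity)]
    have : 0 < (2 * D₁) ^ (q * α / n) := by positivity
    have : 0 < β ^ (q * α / n) := by positivity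
    field_simp
  set f₁ : ℝ → ℝ≥0∞ := fun t => if ENNReal.ofReal a < f t then f t else 0 with hf₁
  set f₂ : ℝ → ℝ≥0∞ := fun t => if ENNReal.ofReal a < f t then 0 else f t with hf₂
  have hset : MeasurableSet {t | ENNReal.ofReal a < f t} := measurableSet_lt measurable_const hf
  have hf₁m : Measurable f₁ := Measurable.ite hset hf measurable_const
  have hsum : (fun t => f₁ t + f₂ t) = f := by
    funext t; simp only [hf₁, hf₂]; split_ifs <;> simp
  have hf₂a : ∀ t, f₂ t ≤ ENNReal.ofReal a := by
    intro t; simp only [hf₂]; split_ifs with h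
    · simp
    · exact not_lt.1 h
  have hsub : {x | ENNReal.ofReal β < shiftConv lam (rieszKernelENN lam α) f x}
      ⊆ {x | ENNReal.ofReal (β / 4) ≤ shiftConv lam (nearKernel lam α ρ) f₁ x} := by
    intro x hx
    simp only [mem_ofPred_eq] at hx ⊢
    by_contra hcon
    refine absurd hx (not_lt.2 ?_)
    rw [shiftConv_split hf ρ x]
    have e1 : shiftConv lam (nearKernel lam α ρ) f x
        = shiftConv lam (nearKernel lam α ρ) f₁ x + shiftConv lam (nearKernel lam α ρ) f₂ x := by
      rw [← shiftConv_add_right (measurable_nearKernel lam α ρ) hf₁m, hsum]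
    have e2 : shiftConv lam (nearKernel lam α ρ) f₂ x ≤ ENNReal.ofReal (β / 4) := by
      refine (shiftConv_near_le hα hρ.le hf₂a x).trans ?_
      rw [← haρ, ENNReal.ofReal_mul (p := D₂ * ρ ^ α) (by positivity)]
      exact mul_le_mul_left (hnear ρ hρ) _
    have e3 := hfar ρ hρ f hf hf1 x
    rw [hρn] at e3
    rw [e1]
    calc _ ≤ ENNReal.ofReal (β / 4) + ENNReal.ofReal (β / 4) + ENNReal.ofReal (β / 2) := by
          gcongr
          exact (not_le.1 hcon).le
      _ = ENNReal.ofReal β := by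
          rw [← ENNReal.ofReal_add (by positivity) (by positivity),
            ← ENNReal.ofReal_add (by positivity) (by positivity)]
          congr 1; ring
  refine (measure_mono hsub).trans ?_
  have hβ4 : ENNReal.ofReal (β / 4) ≠ 0 := by simpa using hβ
  refine (meas_ge_le_lintegral_div (measurable_shiftConv lam
    (measurable_nearKernel lam α ρ) hf₁m).aemeasurable hβ4 ENNReal.ofReal_ne_top).trans ?_
  rw [ENNReal.div_le_iff hβ4 ENNReal.ofReal_ne_top]
  refine (lintegral_shiftConv_near_le hα hρ.le hf₁m).trans ?_
  calc _ ≤ ENNReal.ofReal (D₂ * ρ ^ α) * ∫⁻ t, f₁ t ∂(gegenbauerMeasure lam) := by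
        gcongr
        exact hnear ρ hρ
    _ = _ := by
        rw [mul_right_comm, ← ENNReal.ofReal_mul (by positivity), ← haρ]
        congr 2
        field_simp

lemma shiftConv_eq_zero_of_lintegral_rpow (hp : 0 < p) {k f : ℝ → ℝ≥0∞} (hf : Measurable f)
    (h0 : ∫⁻ t, f t ^ p ∂(gegenbauerMeasure lam) = 0) (x : ℝ) : shiftConv lam k f x = 0 := by
  rw [lintegral_eq_zero_iff (hf.pow_const p)] at h0
  unfold shiftConv
  rw [lintegral_congr_ae (g := fun _ => 0), lintegral_zero]
  filter_upwards [h0] with t ht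
  have : f t = 0 := by simpa [hp, hp.not_gt] using ht
  simp [this]

/-- The Hardy–Littlewood–Sobolev inequality, by homogeneity. -/
lemma shiftConv_strong_type (hlam : 0 < lam) (hα : 0 < α) (hp : 1 < p)
    (hp' : p < (2 * lam + 1) / α) (hpq : 1 / p - 1 / q = α / (2 * lam + 1)) :
    ∃ C : ℝ, 0 < C ∧ ∀ f : ℝ → ℝ≥0∞, Measurable f → (∀ t, f t ≠ ∞) →
      ∫⁻ t, f t ^ p ∂(gegenbauerMeasure lam) ≠ ∞ →
      (∫⁻ x, shiftConv lam (rieszKernelENN lam α) f x ^ q ∂(gegenbauerMeasure lam)) ^ (1 / q)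
        ≤ ENNReal.ofReal C * (∫⁻ t, f t ^ p ∂(gegenbauerMeasure lam)) ^ (1 / p) := by
  have hq : 0 < q := exponent_pos hlam hα hp.le hp' hpq
  have hp0 : 0 < p := by linarith
  obtain ⟨C, hC, h⟩ := shiftConv_strong_type_normalized hlam hα hp hp' hpq
  refine ⟨C ^ (1 / q), by positivity, fun f hf hfin hfp => ?_⟩
  set μ := gegenbauerMeasure lam
  set N := (∫⁻ t, f t ^ p ∂μ) ^ (1 / p) with hN
  by_cases h0 : ∫⁻ t, f t ^ p ∂μ = 0
  · simp [shiftConv_eq_zero_of_lintegral_rpow hp0 hf h0, hq]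
  have hN0 : N ≠ 0 := by
    rw [hN]; simp [h0, hp0.le]
  have hNtop : N ≠ ∞ := ENNReal.rpow_ne_top_of_nonneg (by positivity) hfp
  have hNp : N ^ p = ∫⁻ t, f t ^ p ∂μ := by
    rw [hN, one_div, ENNReal.rpow_inv_rpow hp0.ne']
  have h1 := h (fun t => N⁻¹ * f t) (hf.const_mul _)
    (fun t => ENNReal.mul_ne_top (ENNReal.inv_ne_top.2 hN0) (hfin t)) (by
      simp_rw [ENNReal.mul_rpow_of_nonneg _ _ hp0.le]
      rw [lintegral_const_mul _ (hf.pow_const p), ENNReal.inv_rpow, hNp,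
        ENNReal.inv_mul_cancel h0 hfp])
  have hkm := measurable_rieszKernelENN lam α
  simp_rw [shiftConv_const_mul hkm hf, ENNReal.mul_rpow_of_nonneg _ _ hq.le] at h1
  rw [lintegral_const_mul _ ((measurable_shiftConv lam hkm hf).pow_const q)] at h1
  have h2 := ENNReal.rpow_le_rpow h1 (z := 1 / q) (by positivity)
  rw [ENNReal.mul_rpow_of_nonneg _ _ (by positivity), one_div q, ENNReal.rpow_rpow_inv hq.ne',
    ENNReal.ofReal_rpow_of_pos hC, ← one_div q] at h2
  calc _ = N * (N⁻¹ * (∫⁻ x, shiftConv lam (rieszKernelENN lam α) f x ^ q ∂μ) ^ (1 / q)) := by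
        rw [← mul_assoc, ENNReal.mul_inv_cancel hN0 hNtop, one_mul]
    _ ≤ N * ENNReal.ofReal (C ^ (1 / q)) := by gcongr
    _ = _ := mul_comm _ _

/-- The weak type `(1, q)` estimate for generalized convolution with the Riesz kernel. -/
lemma shiftConv_weak_type (hlam : 0 < lam) (hα : 0 < α) (hα' : α < 2 * lam + 1)
    (hpq : 1 - 1 / q = α / (2 * lam + 1)) :
    ∃ C : ℝ, 0 < C ∧ ∀ f : ℝ → ℝ≥0∞, Measurable f →
      ∫⁻ t, f t ∂(gegenbauerMeasure lam) ≠ ∞ → ∀ β : ℝ, 0 < β →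
      gegenbauerMeasure lam {x | ENNReal.ofReal β < shiftConv lam (rieszKernelENN lam α) f x}
        ≤ (ENNReal.ofReal (C / β) * ∫⁻ t, f t ∂(gegenbauerMeasure lam)) ^ q := by
  set n := 2 * lam + 1 with hn
  have hn0 : 0 < n := by positivity
  have hnα : 0 < n - α := by linarith
  have hq : q = 1 + α / (n - α) := by
    have h1 : 1 / q = (n - α) / n := by
      rw [sub_div, div_self hn0.ne']; linarith
    have h2 : q = n / (n - α) := by rw [← one_div_one_div q, h1, one_div_div]
    rw [h2]; field_simp; ring
  have hq0 : 0 < q := by rw [hq]; positivity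
  obtain ⟨m, hm0, hm⟩ : ∃ m : ℝ, 0 ≤ m ∧ angularMeasure lam univ ≤ ENNReal.ofReal m ∧ 0 < m :=
    ⟨(angularMeasure lam univ).toReal + 1, by positivity,
      (ENNReal.ofReal_toReal (angularMeasure_univ_lt_top hlam).ne).symm.trans_le
        (ENNReal.ofReal_le_ofReal (by linarith)),
      by positivity⟩
  obtain ⟨hm, hmpos⟩ := hm
  set K := 2 * m / α * (2 * m) ^ (α / (n - α)) with hK
  have hK0 : 0 < K := by positivity
  refine ⟨K ^ (1 / q), by positivity, fun f hf hfin β hβ => ?_⟩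
  set μ := gegenbauerMeasure lam
  by_cases h0 : ∫⁻ t, f t ∂μ = 0
  · have h0' : ∫⁻ t, f t ^ (1:ℝ) ∂μ = 0 := by simpa using h0
    simp [shiftConv_eq_zero_of_lintegral_rpow one_pos hf h0']
  obtain ⟨F, hF, hFf⟩ : ∃ F : ℝ, 0 < F ∧ ∫⁻ t, f t ∂μ = ENNReal.ofReal F :=
    ⟨_, ENNReal.toReal_pos h0 hfin, (ENNReal.ofReal_toReal hfin).symm⟩
  -- the radius beyond which the kernel contributes at most `β / 2`
  set ρ := (β / (2 * m * F)) ^ (-(1 / (n - α))) with hρdef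
  have hρ : 0 < ρ := by positivity
  have hρn : m * ρ ^ (α - n) * F = β / 2 := by
    rw [hρdef, ← rpow_mul (by positivity), show -(1 / (n - α)) * (α - n) = 1 by field_simp; ring,
      rpow_one]
    field_simp
  have hfar : ∀ x, shiftConv lam (farKernel lam α ρ) f x ≤ ENNReal.ofReal (β / 2) := by
    intro x
    refine (shiftConv_far_le_one hα' hρ hf x).trans ?_
    rw [hFf, show α - 2 * lam - 1 = α - n by rw [hn]; ring, ← hρn,
      ENNReal.ofReal_mul (by positivity), ENNReal.ofReal_mul (by positivity)]
    gcongr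
  have hsub : {x | ENNReal.ofReal β < shiftConv lam (rieszKernelENN lam α) f x}
      ⊆ {x | ENNReal.ofReal (β / 2) ≤ shiftConv lam (nearKernel lam α ρ) f x} := by
    intro x hx
    simp only [mem_ofPred_eq] at hx ⊢
    by_contra hcon
    refine absurd hx (not_lt.2 ?_)
    rw [shiftConv_split hf ρ x]
    calc _ ≤ ENNReal.ofReal (β / 2) + ENNReal.ofReal (β / 2) :=
          add_le_add (not_le.1 hcon).le (hfar x)
      _ = ENNReal.ofReal β := by
          rw [← ENNReal.ofReal_add (by positivity) (by positivity)]
          congr 1; ring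
  refine (measure_mono hsub).trans ?_
  have hβ2 : ENNReal.ofReal (β / 2) ≠ 0 := by simpa using hβ
  refine (meas_ge_le_lintegral_div (measurable_shiftConv lam
    (measurable_nearKernel lam α ρ) hf).aemeasurable hβ2 ENNReal.ofReal_ne_top).trans ?_
  rw [ENNReal.div_le_iff hβ2 ENNReal.ofReal_ne_top]
  refine (lintegral_shiftConv_near_le hα hρ.le hf).trans ?_
  rw [hFf, ← ENNReal.ofReal_mul (by positivity), ENNReal.ofReal_rpow_of_pos (by positivity),
    ← ENNReal.ofReal_mul (by positivity)]
  calc _ ≤ ENNReal.ofReal m * ENNReal.ofReal (ρ ^ α / α) * ENNReal.ofReal F := by gcongr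
    _ = _ := by
        rw [← ENNReal.ofReal_mul (by positivity), ← ENNReal.ofReal_mul (by positivity)]
        congr 1
        have e1 : ρ ^ α = (2 * m) ^ (α / (n - α)) * (F / β) ^ (α / (n - α)) := by
          rw [hρdef, ← rpow_mul (by positivity),
            show -(1 / (n - α)) * α = -(α / (n - α)) by ring, rpow_neg (by positivity),
            ← inv_rpow (by positivity), ← mul_rpow (by positivity) (by positivity)]
          congr 1; field_simp
        have e2 : (K ^ (1 / q) / β * F) ^ q = K * ((F / β) * (F / β) ^ (α / (n - α))) := by
          rw [show K ^ (1 / q) / β * F = K ^ (1 / q) * (F / β) by ring,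
            mul_rpow (by positivity) (by positivity), ← rpow_mul hK0.le, one_div,
            inv_mul_cancel₀ hq0.ne', rpow_one, hq, rpow_add (by positivity), rpow_one]
        rw [e1, e2, hK]
        field_simp

end operator

/-! ### The decaying eigenfunction -/

@[fun_prop]
lemma measurable_real_Gamma : Measurable Gamma := by
  have h1 : Measurable (fun s : ℂ => (Complex.Gamma s)⁻¹) :=
    Complex.differentiable_one_div_Gamma.continuous.measurable
  have h2 : Measurable Complex.Gamma := by
    have h := h1.inv
    rwa [show (fun s : ℂ => (Complex.Gamma s)⁻¹)⁻¹ = Complex.Gamma from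
      funext fun s => inv_inv _] at h
  have h3 : Gamma = fun s : ℝ => (Complex.Gamma (s : ℂ)).re := by
    funext s; rw [Complex.Gamma_ofReal, Complex.ofReal_re]
  rw [h3]
  exact Complex.measurable_re.comp (h2.comp Complex.measurable_ofReal)

lemma measurable_gegenbauerP (lam : ℝ) :
    Measurable (fun p : ℝ × ℝ => gegenbauerP lam p.1 p.2) := by
  unfold gegenbauerP
  simp only [ordinaryHypergeometric_eq_tsum, smul_eq_mul]
  have hpoly : ∀ (n : ℕ), Measurable (fun s : ℝ => (ascPochhammer ℝ n).eval s) :=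
    fun n => (ascPochhammer ℝ n).continuous.measurable
  refine Measurable.mul (by fun_prop) (Measurable.tsum fun n => ?_)
  refine Measurable.mul (Measurable.mul (Measurable.mul (Measurable.mul measurable_const ?_) ?_) ?_)
    (by fun_prop)
  · exact (hpoly n).comp (by fun_prop)
  · exact (hpoly n).comp (by fun_prop)
  · exact ((hpoly n).comp (f := fun p : ℝ × ℝ => p.1 + lam + 1) (by fun_prop)).inv

lemma ascPochhammer_eval_eq_Gamma {s : ℝ} (hs : 0 < s) (k : ℕ) :
    (ascPochhammer ℝ k).eval s = Gamma (s + k) / Gamma s := by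
  have hG : Gamma s ≠ 0 := (Gamma_pos_of_pos hs).ne'
  induction k with
  | zero => simp [hG]
  | succ k ih =>
    rw [ascPochhammer_succ_eval, ih, Nat.cast_succ, ← add_assoc,
      Gamma_add_one (by positivity : s + k ≠ 0)]
    ring

/-- Consequence of the log-convexity of `Γ`: the arguments `u`, `v` are further apart than
`z`, `z + 1/2`, and `u + v` exceeds `2z + 1/2` by `3/2 - λ`. -/
lemma Gamma_mul_Gamma_le {lam z u v : ℝ} (hlam : 0 < lam) (hlam' : lam < 1 / 2) (hz : 1 / 2 ≤ z)
    (hu : 0 < u) (hv : 0 < v) (huv : u + v = 2 * z + 2 - lam) :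
    Gamma z * Gamma (z + 1 / 2) ≤ 3 * z ^ (lam - 3 / 2) * (Gamma u * Gamma v) := by
  have hz0 : 0 < z := by linarith
  set M := z + 1 - lam / 2 with hM
  have hM0 : 0 < M := by linarith
  have hGz : 0 < Gamma z := Gamma_pos_of_pos hz0
  have hGu : 0 < Gamma u := Gamma_pos_of_pos hu
  have hGv : 0 < Gamma v := Gamma_pos_of_pos hv
  have hGM : 0 < Gamma M := Gamma_pos_of_pos hM0
  have h1 : Gamma (z + 1 / 2) ≤ Gamma z * z ^ (1 / 2 : ℝ) := by
    have h := Gamma_mul_add_mul_le_rpow_Gamma_mul_rpow_Gamma hz0 (by linarith : 0 < z + 1)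
      (a := 1 / 2) (b := 1 / 2) (by norm_num) (by norm_num) (by norm_num)
    rw [show 1 / 2 * z + 1 / 2 * (z + 1) = z + 1 / 2 by ring, Gamma_add_one hz0.ne',
      mul_rpow hz0.le hGz.le] at h
    have e : Gamma z ^ (1 / 2 : ℝ) * Gamma z ^ (1 / 2 : ℝ) = Gamma z := by
      rw [← rpow_add hGz]; norm_num
    calc _ ≤ _ := h
      _ = (Gamma z ^ (1 / 2 : ℝ) * Gamma z ^ (1 / 2 : ℝ)) * z ^ (1 / 2 : ℝ) := by ring
      _ = _ := by rw [e]
  have h2 : Gamma M ^ 2 ≤ Gamma u * Gamma v := by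
    have h := Gamma_mul_add_mul_le_rpow_Gamma_mul_rpow_Gamma hu hv
      (a := 1 / 2) (b := 1 / 2) (by norm_num) (by norm_num) (by norm_num)
    rw [show 1 / 2 * u + 1 / 2 * v = M by rw [hM]; linarith, ← mul_rpow hGu.le hGv.le,
      ← sqrt_eq_rpow] at h
    calc Gamma M ^ 2 ≤ √(Gamma u * Gamma v) ^ 2 := by gcongr
      _ = _ := sq_sqrt (by positivity)
  have h3 : z * Gamma z ≤ Gamma M * M ^ (lam / 2) := by
    have h := Gamma_mul_add_mul_le_rpow_Gamma_mul_rpow_Gamma hM0 (by linarith : 0 < M + 1)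
      (a := 1 - lam / 2) (b := lam / 2) (by linarith) (by linarith) (by linarith)
    rw [show (1 - lam / 2) * M + lam / 2 * (M + 1) = z + 1 by rw [hM]; ring,
      Gamma_add_one hz0.ne', Gamma_add_one hM0.ne', mul_rpow hM0.le hGM.le] at h
    have e : Gamma M ^ (1 - lam / 2) * Gamma M ^ (lam / 2) = Gamma M := by
      rw [← rpow_add hGM]; norm_num
    calc _ ≤ _ := h
      _ = (Gamma M ^ (1 - lam / 2) * Gamma M ^ (lam / 2)) * M ^ (lam / 2) := by ring
      _ = _ := by rw [e]
  have h4 : M ^ lam ≤ 3 * z ^ lam := by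
    calc M ^ lam ≤ (3 * z) ^ lam := by gcongr; linarith
      _ = 3 ^ lam * z ^ lam := mul_rpow (by norm_num) hz0.le
      _ ≤ 3 ^ (1 : ℝ) * z ^ lam := by
          gcongr
          · norm_num
          · linarith
      _ = _ := by rw [rpow_one]
  have hzp : 0 < z ^ (-(3 / 2) : ℝ) := by positivity
  calc Gamma z * Gamma (z + 1 / 2) ≤ Gamma z * (Gamma z * z ^ (1 / 2 : ℝ)) := by gcongr
    _ = z ^ (-(3 / 2) : ℝ) * (z * Gamma z) ^ 2 := by
        rw [show (1 / 2 : ℝ) = -(3 / 2) + 2 by norm_num, rpow_add hz0, rpow_two]; ring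
    _ ≤ z ^ (-(3 / 2) : ℝ) * (Gamma M * M ^ (lam / 2)) ^ 2 := by gcongr
    _ = z ^ (-(3 / 2) : ℝ) * (M ^ lam * Gamma M ^ 2) := by
        rw [mul_pow, ← rpow_mul_natCast hM0.le, Nat.cast_ofNat, div_mul_cancel₀ _ two_ne_zero,
          mul_comm (Gamma M ^ 2)]
    _ ≤ z ^ (-(3 / 2) : ℝ) * (3 * z ^ lam * (Gamma u * Gamma v)) := by gcongr
    _ = _ := by rw [sub_eq_add_neg, rpow_add hz0]; ring

/-- The Gauss series of the eigenfunction at `y = 1` is dominated by a series independent of `γ`;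
it converges since `λ < 1/2`. -/
lemma gauss_term_bound {lam γ : ℝ} (hlam : 0 < lam) (hlam' : lam < 1 / 2) (hγ : 1 < γ) (k : ℕ) :
    0 ≤ Gamma (γ + 2 * lam) / Gamma (γ + lam + 1) * 2 ^ (-γ - 2 * lam) *
      ((k.factorial : ℝ)⁻¹ * (ascPochhammer ℝ k).eval (γ / 2 + lam) *
        (ascPochhammer ℝ k).eval (γ / 2 + lam + 1 / 2) *
        ((ascPochhammer ℝ k).eval (γ + lam + 1))⁻¹) ∧
    Gamma (γ + 2 * lam) / Gamma (γ + lam + 1) * 2 ^ (-γ - 2 * lam) *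
      ((k.factorial : ℝ)⁻¹ * (ascPochhammer ℝ k).eval (γ / 2 + lam) *
        (ascPochhammer ℝ k).eval (γ / 2 + lam + 1 / 2) *
        ((ascPochhammer ℝ k).eval (γ + lam + 1))⁻¹)
      ≤ 3 * (1 / |(k : ℝ) + 1 / 2| ^ (3 / 2 - lam)) := by
  have hγ0 : 0 < γ := by linarith
  set a := γ / 2 + lam with ha
  have ha0 : 0 < a := by positivity
  have hk0 : (0 : ℝ) ≤ k := Nat.cast_nonneg k
  rw [ascPochhammer_eval_eq_Gamma ha0, ascPochhammer_eval_eq_Gamma (by positivity),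
    ascPochhammer_eval_eq_Gamma (by positivity : 0 < γ + lam + 1), ← Gamma_nat_eq_factorial]
  have hdup := Gamma_mul_Gamma_add_half_of_pos ha0
  have h2a : 2 * a = γ + 2 * lam := by rw [ha]; ring
  rw [h2a, sub_eq_add_neg (1 : ℝ), rpow_add two_pos, rpow_one, neg_add, ← sub_eq_add_neg] at hdup
  have g1 : 0 < Gamma a := Gamma_pos_of_pos ha0
  have g2 : 0 < Gamma (a + 1 / 2) := Gamma_pos_of_pos (by positivity)
  have g3 : 0 < Gamma (γ + lam + 1) := Gamma_pos_of_pos (by positivity)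
  have g4 : 0 < Gamma (γ + lam + 1 + k) := Gamma_pos_of_pos (by positivity)
  have g5 : 0 < Gamma ((k : ℝ) + 1) := Gamma_pos_of_pos (by positivity)
  have g6 : 0 < Gamma (a + k) := Gamma_pos_of_pos (by positivity)
  have g7 : 0 < Gamma (a + 1 / 2 + k) := Gamma_pos_of_pos (by positivity)
  have g8 : 0 < Gamma (γ + 2 * lam) := Gamma_pos_of_pos (by positivity)
  have hπ : 1 ≤ 2 * √π := by
    have : 1 ≤ √π := by rw [one_le_sqrt]; linarith [pi_gt_three]
    linarith
  refine ⟨by positivity, ?_⟩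
  set E : ℝ := 2 ^ (-γ - 2 * lam) with hE
  have hmain := Gamma_mul_Gamma_le hlam hlam' (z := a + k) (u := γ + lam + 1 + k) (v := k + 1)
    (by linarith) (by positivity) (by positivity) (by rw [ha]; ring)
  rw [show a + k + 1 / 2 = a + 1 / 2 + k by ring] at hmain
  have hdup' : Gamma (γ + 2 * lam) * E = Gamma a * Gamma (a + 1 / 2) / (2 * √π) := by
    rw [hdup]; field_simp
  calc _ = (Gamma (γ + 2 * lam) * E) * (Gamma (a + k) * Gamma (a + 1 / 2 + k)) /
          (Gamma a * Gamma (a + 1 / 2) * (Gamma (γ + lam + 1 + k) * Gamma (k + 1))) := by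
        field_simp
    _ = (Gamma (a + k) * Gamma (a + 1 / 2 + k)) /
          (Gamma (γ + lam + 1 + k) * Gamma (k + 1)) / (2 * √π) := by
        rw [hdup']; field_simp
    _ ≤ (Gamma (a + k) * Gamma (a + 1 / 2 + k)) /
          (Gamma (γ + lam + 1 + k) * Gamma (k + 1)) := div_le_self (by positivity) hπ
    _ ≤ 3 * (a + k) ^ (lam - 3 / 2) := by rwa [div_le_iff₀ (by positivity)]
    _ ≤ 3 * (k + 1 / 2) ^ (lam - 3 / 2) := by
        gcongr 3 * ?_
        exact rpow_le_rpow_of_nonpos (by positivity) (by linarith) (by linarith)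
    _ = _ := by
        rw [abs_of_pos (by positivity), one_div (_ ^ _), ← rpow_neg (by positivity), neg_sub]

/-- The eigenfunction decays like `y^{-γ-2λ}`, uniformly in `γ > 1` and up to `y = 1`. -/
lemma abs_gegenbauerP_le {lam : ℝ} (hlam : 0 < lam) (hlam' : lam < 1 / 2) :
    ∃ C : ℝ, 0 < C ∧ ∀ γ y : ℝ, 1 < γ → 1 ≤ y →
      |gegenbauerP lam γ y| ≤ C * y ^ (-γ - 2 * lam) := by
  have hsum : Summable (fun k : ℕ => 3 * (1 / |(k : ℝ) + 1 / 2| ^ (3 / 2 - lam))) :=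
    ((summable_one_div_nat_add_rpow (1 / 2) (3 / 2 - lam)).2 (by linarith)).mul_left 3
  set B := ∑' k : ℕ, 3 * (1 / |(k : ℝ) + 1 / 2| ^ (3 / 2 - lam)) with hB
  have hB0 : 0 ≤ B := tsum_nonneg fun k => by positivity
  have hG : 0 < Gamma lam := Gamma_pos_of_pos hlam
  refine ⟨(B + 1) / Gamma lam, by positivity, fun γ y hγ hy => ?_⟩
  have hy0 : 0 < y := by linarith
  set u : ℕ → ℝ := fun k => Gamma (γ + 2 * lam) / Gamma (γ + lam + 1) * 2 ^ (-γ - 2 * lam) *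
      ((k.factorial : ℝ)⁻¹ * (ascPochhammer ℝ k).eval (γ / 2 + lam) *
        (ascPochhammer ℝ k).eval (γ / 2 + lam + 1 / 2) *
        ((ascPochhammer ℝ k).eval (γ + lam + 1))⁻¹) with hu
  have hub := fun k => gauss_term_bound hlam hlam' hγ k
  have hx0 : 0 ≤ 1 / y ^ 2 := by positivity
  have hx1 : 1 / y ^ 2 ≤ 1 := by
    rw [div_le_one (by positivity)]
    exact one_le_pow₀ hy
  have hle : ∀ k, u k * (1 / y ^ 2) ^ k ≤ 3 * (1 / |(k : ℝ) + 1 / 2| ^ (3 / 2 - lam)) := fun k =>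
    (mul_le_of_le_one_right (hub k).1 (pow_le_one₀ hx0 hx1)).trans (hub k).2
  have hnn : ∀ k, 0 ≤ u k * (1 / y ^ 2) ^ k := fun k => mul_nonneg (hub k).1 (pow_nonneg hx0 k)
  have hS : ∑' k, u k * (1 / y ^ 2) ^ k ≤ B :=
    (Summable.of_nonneg_of_le hnn hle hsum).tsum_le_tsum hle hsum
  have hS0 : 0 ≤ ∑' k, u k * (1 / y ^ 2) ^ k := tsum_nonneg hnn
  have hP : gegenbauerP lam γ y =
      cos (π * lam) / Gamma lam * y ^ (-γ - 2 * lam) * ∑' k, u k * (1 / y ^ 2) ^ k := by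
    have e : ∀ k, u k * (1 / y ^ 2) ^ k =
        (Gamma (γ + 2 * lam) / Gamma (γ + lam + 1) * 2 ^ (-γ - 2 * lam)) *
        ((k.factorial : ℝ)⁻¹ * (ascPochhammer ℝ k).eval (γ / 2 + lam) *
        (ascPochhammer ℝ k).eval (γ / 2 + lam + 1 / 2) *
        ((ascPochhammer ℝ k).eval (γ + lam + 1))⁻¹ * (1 / y ^ 2) ^ k) := by
      intro k; simp only [hu]; ring
    simp only [e]
    rw [tsum_mul_left, gegenbauerP, ordinaryHypergeometric_eq_tsum,
      mul_rpow two_pos.le hy0.le]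
    simp only [smul_eq_mul]
    have g3 : Gamma (γ + lam + 1) ≠ 0 := (Gamma_pos_of_pos (by linarith)).ne'
    field_simp
  have hyp : 0 < y ^ (-γ - 2 * lam) := by positivity
  rw [hP, abs_mul, abs_mul, abs_div, abs_of_pos hG, abs_of_pos hyp, abs_of_nonneg hS0]
  calc _ ≤ 1 / Gamma lam * y ^ (-γ - 2 * lam) * (B + 1) := by
        gcongr
        · exact abs_cos_le_one _
        · linarith
    _ = _ := by ring

/-! ### The potential kernel -/

/-- Bernoulli's inequality turns the decay of `ch^{-γ-2λ}` in `γ` into a power of `γ sh²`. -/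
lemma cosh_rpow_le {lam m γ x : ℝ} (hlam : 0 < lam) (hm : 0 < m) (hm' : m < 2 * lam + 1)
    (hγ : 1 < γ) (hx : 0 < x) :
    cosh x ^ (-γ - 2 * lam) ≤ m ^ (m / 2) * sinh x ^ (-m) * γ ^ (-(m / 2)) := by
  have hs : 0 < sinh x := sinh_pos_iff.2 hx
  have hc : 0 < cosh x := cosh_pos x
  have hγ0 : 0 < γ := by linarith
  set E := γ + 2 * lam with hE
  have hEm : 1 ≤ E / m := by rw [le_div_iff₀ hm]; linarith
  have h1 : γ / m * sinh x ^ 2 ≤ (cosh x ^ 2) ^ (E / m) := by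
    have h := one_add_mul_self_le_rpow_one_add (s := sinh x ^ 2) (by nlinarith) hEm
    rw [add_comm 1 (sinh x ^ 2), ← cosh_sq] at h
    have : γ / m * sinh x ^ 2 ≤ E / m * sinh x ^ 2 := by gcongr; linarith
    linarith
  have h2 : (γ / m * sinh x ^ 2) ^ (m / 2) ≤ cosh x ^ E := by
    calc _ ≤ ((cosh x ^ 2) ^ (E / m)) ^ (m / 2) := by gcongr
      _ = cosh x ^ E := by
        rw [← rpow_natCast, ← rpow_mul hc.le, ← rpow_mul hc.le]
        congr 1; push_cast; field_simp
  have h3 : (γ / m * sinh x ^ 2) ^ (m / 2)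
      = (m ^ (m / 2) * sinh x ^ (-m) * γ ^ (-(m / 2)))⁻¹ := by
    rw [mul_rpow (by positivity) (by positivity), div_rpow hγ0.le hm.le, ← rpow_natCast,
      ← rpow_mul hs.le, show ((2 : ℕ) : ℝ) * (m / 2) = m by push_cast; ring, rpow_neg hs.le,
      rpow_neg hγ0.le]
    field_simp
  rw [show -γ - 2 * lam = -E by rw [hE]; ring, rpow_neg hc.le]
  rw [h3] at h2
  exact inv_le_of_inv_le₀ (by positivity) h2

/-- Integrability of the spectral density: near `1` since `λ > 0`, at infinity since `e > 2λ`. -/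
lemma integrableOn_rpow_neg_mul_sq_sub_one {lam e : ℝ} (hlam : 0 < lam) (hlam' : lam < 1 / 2)
    (he : 2 * lam < e) :
    IntegrableOn (fun γ : ℝ => γ ^ (-e) * (γ ^ 2 - 1) ^ (lam - 1 / 2)) (Ioi 1) := by
  have hm : Measurable (fun γ : ℝ => γ ^ (-e) * (γ ^ 2 - 1) ^ (lam - 1 / 2)) := by fun_prop
  rw [← Ioc_union_Ioi_eq_Ioi (show (1 : ℝ) ≤ 2 by norm_num)]
  refine IntegrableOn.union ?_ ?_
  · have h1 : IntegrableOn (fun γ : ℝ => (γ - 1) ^ (lam - 1 / 2)) (Ioc 1 2) := by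
      rw [← intervalIntegrable_iff_integrableOn_Ioc_of_le (by norm_num)]
      have := (intervalIntegral.intervalIntegrable_rpow' (a := 0) (b := 1)
        (r := lam - 1 / 2) (by linarith)).comp_sub_right 1
      norm_num at this
      simpa using this
    refine Integrable.mono' h1 hm.aestronglyMeasurable ?_
    filter_upwards [ae_restrict_mem measurableSet_Ioc] with γ hγ
    have hγ1 : 0 < γ - 1 := by linarith [hγ.1]
    have hsq : 0 < γ ^ 2 - 1 := by nlinarith
    have hγ0 : 0 < γ := by linarith
    rw [norm_of_nonneg (by positivity)]
    calc _ ≤ 1 * (γ - 1) ^ (lam - 1 / 2) := by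
          gcongr ?_ * ?_
          · exact rpow_le_one_of_one_le_of_nonpos (by linarith) (by linarith)
          · exact rpow_le_rpow_of_nonpos hγ1 (by nlinarith) (by linarith)
      _ = _ := one_mul _
  · have h1 : IntegrableOn (fun γ : ℝ => (1 / 4) ^ (lam - 1 / 2) * γ ^ (2 * lam - 1 - e)) (Ioi 2) :=
      (integrableOn_Ioi_rpow_of_lt (by linarith) (by norm_num)).const_mul _
    refine Integrable.mono' h1 hm.aestronglyMeasurable ?_
    filter_upwards [ae_restrict_mem measurableSet_Ioi] with γ hγ
    have hγ2 : (2 : ℝ) < γ := hγ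
    have hγ0 : 0 < γ := by linarith
    have hsq : 0 < γ ^ 2 - 1 := by nlinarith
    rw [norm_of_nonneg (by positivity)]
    calc _ ≤ γ ^ (-e) * (1 / 4 * γ ^ 2) ^ (lam - 1 / 2) := by
          gcongr _ * ?_
          exact rpow_le_rpow_of_nonpos (by positivity) (by nlinarith) (by linarith)
      _ = _ := by
          rw [mul_rpow (by norm_num) (by positivity), ← rpow_natCast, ← rpow_mul hγ0.le,
            show 2 * lam - 1 - e = -e + ((2 : ℕ) : ℝ) * (lam - 1 / 2) by push_cast; ring,
            rpow_add hγ0]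
          ring

lemma measurable_gegenbauerHeatIntegrand (lam : ℝ) :
    Measurable (fun p : (ℝ × ℝ) × ℝ => gegenbauerHeatIntegrand lam p.1.2 p.1.1 p.2) := by
  unfold gegenbauerHeatIntegrand
  refine Measurable.mul (Measurable.mul (by fun_prop) ?_) (by fun_prop)
  exact (measurable_gegenbauerP lam).comp (f := fun p : (ℝ × ℝ) × ℝ => (p.2, cosh p.1.1))
    (by fun_prop)

lemma measurable_gegenbauerHeat (lam : ℝ) :
    Measurable (fun p : ℝ × ℝ => gegenbauerHeat lam p.2 p.1) := by
  unfold gegenbauerHeat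
  exact ((measurable_gegenbauerHeatIntegrand lam).stronglyMeasurable.integral_prod_right
    (ν := volume.restrict (Ioi 1))).measurable

/-- The kernel of the potential, up to the factor `Γ(α/2)⁻¹`. -/
def potentialKernel (lam α x : ℝ) : ℝ :=
  ∫ r in Ioi (0 : ℝ), r ^ (α / 2 - 1) * gegenbauerHeat lam r x

lemma measurable_potentialKernel (lam α : ℝ) : Measurable (potentialKernel lam α) := by
  unfold potentialKernel
  have h : Measurable (fun p : ℝ × ℝ => p.2 ^ (α / 2 - 1) * gegenbauerHeat lam p.2 p.1) :=
    Measurable.mul (by fun_prop) (measurable_gegenbauerHeat lam)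
  exact (h.stronglyMeasurable.integral_prod_right (ν := volume.restrict (Ioi 0))).measurable

lemma norm_gegenbauerHeatIntegrand_le {lam C r x γ : ℝ} (hlam : 0 < lam)
    (hr : 0 < r) (hγ : 1 < γ)
    (hP : |gegenbauerP lam γ (cosh x)| ≤ C) :
    ‖gegenbauerHeatIntegrand lam r x γ‖
      ≤ exp (-(γ ^ 2 * r)) * C * (γ ^ 2 - 1) ^ (lam - 1 / 2) := by
  have hsq : 0 < γ ^ 2 - 1 := by nlinarith
  have hp : 0 < (γ ^ 2 - 1) ^ (lam - 1 / 2) := by positivity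
  have hC : 0 ≤ C := (abs_nonneg _).trans hP
  rw [gegenbauerHeatIntegrand, norm_mul, norm_mul, norm_of_nonneg (exp_pos _).le,
    norm_of_nonneg hp.le, norm_eq_abs]
  gcongr
  nlinarith [mul_pos (mul_pos (by linarith : 0 < γ) hlam) hr]

lemma integrableOn_gegenbauerHeatIntegrand {lam r x : ℝ} (hlam : 0 < lam) (hlam' : lam < 1 / 2)
    (hr : 0 < r) : IntegrableOn (gegenbauerHeatIntegrand lam r x) (Ioi 1) := by
  obtain ⟨C, hC, hP⟩ := abs_gegenbauerP_le hlam hlam'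
  have hm : Measurable (gegenbauerHeatIntegrand lam r x) :=
    (measurable_gegenbauerHeatIntegrand lam).comp (f := fun γ : ℝ => ((x, r), γ)) (by fun_prop)
  refine Integrable.mono' ((integrableOn_rpow_neg_mul_sq_sub_one (e := 2) hlam hlam'
    (by linarith)).const_mul (C / r)) hm.aestronglyMeasurable ?_
  filter_upwards [ae_restrict_mem measurableSet_Ioi] with γ hγ
  have hγ1 : (1 : ℝ) < γ := hγ
  have hγ0 : 0 < γ := by linarith
  have hsq : 0 < γ ^ 2 - 1 := by nlinarith
  have hPC : |gegenbauerP lam γ (cosh x)| ≤ C := (hP γ _ hγ1 (one_le_cosh x)).trans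
    (mul_le_of_le_one_right hC.le
      (rpow_le_one_of_one_le_of_nonpos (one_le_cosh x) (by linarith)))
  refine (norm_gegenbauerHeatIntegrand_le hlam hr hγ1 hPC).trans ?_
  have hexp : exp (-(γ ^ 2 * r)) ≤ (γ ^ 2 * r)⁻¹ := by
    rw [exp_neg]
    exact inv_anti₀ (by positivity) (by linarith [add_one_le_exp (γ ^ 2 * r)])
  calc _ ≤ (γ ^ 2 * r)⁻¹ * C * (γ ^ 2 - 1) ^ (lam - 1 / 2) := by gcongr
    _ = _ := by rw [rpow_neg hγ0.le, rpow_two]; field_simp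

lemma lintegral_rpow_mul_exp {a b : ℝ} (ha : 0 < a) (hb : 0 < b) :
    ∫⁻ r in Ioi 0, ENNReal.ofReal (r ^ (a - 1) * exp (-(b * r)))
      = ENNReal.ofReal ((1 / b) ^ a * Gamma a) := by
  rw [← integral_rpow_mul_exp_neg_mul_Ioi ha hb, ofReal_integral_eq_lintegral_ofReal]
  · have := integrableOn_rpow_mul_exp_neg_mul_rpow (s := a - 1) (p := 1) (b := b)
      (by linarith) one_pos hb
    simpa only [rpow_one, neg_mul] using! this
  · filter_upwards [ae_restrict_mem measurableSet_Ioi] with r hr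
    exact mul_nonneg (rpow_nonneg (le_of_lt hr) _) (exp_pos _).le

/-- The potential kernel is dominated by the Riesz kernel. -/
lemma lintegral_gegenbauerHeat_le {lam α : ℝ} (hlam : 0 < lam) (hlam' : lam < 1 / 2)
    (hα : 0 < α) (hα' : α < 2 * lam + 1) :
    ∃ C : ℝ, 0 < C ∧ ∀ x : ℝ, 0 < x →
      ∫⁻ r in Ioi 0, ‖r ^ (α / 2 - 1) * gegenbauerHeat lam r x‖ₑ
        ≤ ENNReal.ofReal (C * rieszKernel lam α (cosh x)) := by
  obtain ⟨C₀, hC₀, hP⟩ := abs_gegenbauerP_le hlam hlam'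
  set m := 2 * lam + 1 - α with hm
  have hm0 : 0 < m := by linarith
  -- the `r`-integral contributes `γ^{-α}`, the decay in `γ sh² x` a factor `γ^{-m/2}`
  have hJ := integrableOn_rpow_neg_mul_sq_sub_one (e := α + m / 2) hlam hlam' (by linarith)
  have hJ' := hJ.lintegral_lt_top
  set J := ∫⁻ γ in Ioi (1 : ℝ), ENNReal.ofReal (γ ^ (-(α + m / 2)) * (γ ^ 2 - 1) ^ (lam - 1 / 2))
    with hJdef
  set K := C₀ * m ^ (m / 2) with hK
  have hK0 : 0 < K := by positivity
  have hG : 0 < Gamma (α / 2) := Gamma_pos_of_pos (by positivity)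
  refine ⟨K * Gamma (α / 2) * (J.toReal + 1), by positivity, fun x hx => ?_⟩
  have hs : 0 < sinh x := sinh_pos_iff.2 hx
  have hpt : ∀ r : ℝ, 0 < r → ‖r ^ (α / 2 - 1) * gegenbauerHeat lam r x‖ₑ ≤
      ∫⁻ γ in Ioi (1 : ℝ), ENNReal.ofReal (K * sinh x ^ (-m)) *
        (ENNReal.ofReal (γ ^ (-(m / 2)) * (γ ^ 2 - 1) ^ (lam - 1 / 2)) *
          ENNReal.ofReal (r ^ (α / 2 - 1) * exp (-(γ ^ 2 * r)))) := by
    intro r hr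
    rw [enorm_mul]
    calc _ ≤ ‖r ^ (α / 2 - 1)‖ₑ * ∫⁻ γ in Ioi (1 : ℝ), ‖gegenbauerHeatIntegrand lam r x γ‖ₑ := by
          gcongr
          exact enorm_integral_le_lintegral_enorm _
      _ = ∫⁻ γ in Ioi (1 : ℝ), ‖r ^ (α / 2 - 1)‖ₑ * ‖gegenbauerHeatIntegrand lam r x γ‖ₑ :=
          (lintegral_const_mul' _ _ (by simp)).symm
      _ ≤ _ := by
          refine setLIntegral_mono' measurableSet_Ioi fun γ hγ => ?_
          have hγ1 : (1 : ℝ) < γ := hγ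
          have hγ0 : 0 < γ := by linarith
          have hsq : 0 < γ ^ 2 - 1 := by nlinarith
          have hPC : |gegenbauerP lam γ (cosh x)|
              ≤ C₀ * (m ^ (m / 2) * sinh x ^ (-m) * γ ^ (-(m / 2))) :=
            (hP γ _ hγ1 (one_le_cosh x)).trans (by
              gcongr
              exact cosh_rpow_le hlam hm0 (by linarith) hγ1 hx)
          rw [← enorm_mul, ← ofReal_norm, ← ENNReal.ofReal_mul (by positivity),
            ← ENNReal.ofReal_mul (by positivity)]
          refine ENNReal.ofReal_le_ofReal ?_
          rw [norm_mul, norm_of_nonneg (rpow_nonneg hr.le _)]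
          refine (mul_le_mul_of_nonneg_left (norm_gegenbauerHeatIntegrand_le hlam hr hγ1 hPC)
            (rpow_nonneg hr.le _)).trans_eq ?_
          rw [hK]; ring
  calc ∫⁻ r in Ioi 0, ‖r ^ (α / 2 - 1) * gegenbauerHeat lam r x‖ₑ
      ≤ ∫⁻ r in Ioi (0 : ℝ), ∫⁻ γ in Ioi (1 : ℝ), ENNReal.ofReal (K * sinh x ^ (-m)) *
        (ENNReal.ofReal (γ ^ (-(m / 2)) * (γ ^ 2 - 1) ^ (lam - 1 / 2)) *
          ENNReal.ofReal (r ^ (α / 2 - 1) * exp (-(γ ^ 2 * r)))) :=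
        setLIntegral_mono' measurableSet_Ioi hpt
    _ = ∫⁻ γ in Ioi (1 : ℝ), ∫⁻ r in Ioi (0 : ℝ), ENNReal.ofReal (K * sinh x ^ (-m)) *
        (ENNReal.ofReal (γ ^ (-(m / 2)) * (γ ^ 2 - 1) ^ (lam - 1 / 2)) *
          ENNReal.ofReal (r ^ (α / 2 - 1) * exp (-(γ ^ 2 * r)))) :=
        lintegral_lintegral_swap (by fun_prop)
    _ = ∫⁻ γ in Ioi (1 : ℝ), ENNReal.ofReal (K * sinh x ^ (-m) * Gamma (α / 2)) *
          ENNReal.ofReal (γ ^ (-(α + m / 2)) * (γ ^ 2 - 1) ^ (lam - 1 / 2)) := by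
        refine setLIntegral_congr_fun measurableSet_Ioi fun γ hγ => ?_
        have hγ1 : (1 : ℝ) < γ := hγ
        have hγ0 : 0 < γ := by linarith
        have hsq : 0 < γ ^ 2 - 1 := by nlinarith
        rw [lintegral_const_mul' _ _ (by simp), lintegral_const_mul' _ _ (by simp),
          lintegral_rpow_mul_exp (by positivity) (by positivity),
          ← ENNReal.ofReal_mul (by positivity), ← ENNReal.ofReal_mul (by positivity),
          ← ENNReal.ofReal_mul (by positivity)]
        congr 1
        have e : (1 / γ ^ 2) ^ (α / 2) = γ ^ (-α) := by
          rw [one_div, inv_rpow (by positivity), ← rpow_natCast, ← rpow_mul hγ0.le, rpow_neg hγ0.le]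
          congr 2; push_cast; ring
        rw [e, neg_add, rpow_add hγ0]
        ring
    _ = ENNReal.ofReal (K * sinh x ^ (-m) * Gamma (α / 2)) * J :=
        lintegral_const_mul' _ _ (by simp)
    _ ≤ ENNReal.ofReal (K * sinh x ^ (-m) * Gamma (α / 2)) * ENNReal.ofReal (J.toReal + 1) := by
        gcongr
        calc J = ENNReal.ofReal J.toReal := (ENNReal.ofReal_toReal hJ'.ne).symm
          _ ≤ _ := ENNReal.ofReal_le_ofReal (by linarith)
    _ = _ := by
        rw [← ENNReal.ofReal_mul (by positivity), rieszKernel_cosh lam α hx.le,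
          show α - 2 * lam - 1 = -m by rw [hm]; ring]
        congr 1; ring

/-! ### Reduction to measurable functions -/

section transfer

variable {E : Type*} [NormedAddCommGroup E] {lam α p q : ℝ} {f g : ℝ → E}

lemma measurable_arcosh : Measurable arcosh := by
  unfold arcosh; fun_prop

/-- The shift preserves null sets, since it preserves the measure up to a constant. -/
lemma ae_ae_coshSide {P : ℝ → Prop} (hP : ∀ᵐ u ∂(gegenbauerMeasure lam), P u) (t : ℝ) :
    ∀ᵐ x ∂(gegenbauerMeasure lam), ∀ᵐ φ ∂(angularMeasure lam), P (arcosh (coshSide x t φ)) := by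
  obtain ⟨S, hS, hSm, hS0⟩ := exists_measurable_superset_of_null (ae_iff.1 hP)
  have hGm : Measurable (fun z => S.indicator (fun _ => (1 : ℝ≥0∞)) (arcosh z)) :=
    (measurable_const.indicator hSm).comp measurable_arcosh
  have h := lintegral_coshSide lam t _ hGm
  have h0 : ∫⁻ u, S.indicator (fun _ => (1 : ℝ≥0∞)) (arcosh (cosh u)) ∂(gegenbauerMeasure lam)
      = 0 := by
    rw [lintegral_congr_ae (g := S.indicator (fun _ => (1 : ℝ≥0∞))), lintegral_indicator hSm]
    · simp [hS0]
    · filter_upwards [ae_gegenbauerMeasure_pos lam] with u hu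
      rw [arcosh_cosh hu.le]
  rw [h0, mul_zero, lintegral_eq_zero_iff] at h
  · filter_upwards [h] with x hx
    rw [Pi.zero_apply, lintegral_eq_zero_iff (by simpa using measurable_kernel_right hGm x t)] at hx
    filter_upwards [hx] with φ hφ
    by_contra hcon
    have : arcosh (coshSide x t φ) ∈ S := hS hcon
    simp [this] at hφ
  · simp_rw [coshSide_comm _ t]
    exact (measurable_kernel_prod hGm t).lintegral_prod_right'

/-- Two functions on `[1, ∞)` that the fractional integral and the potential cannot distinguish. -/
structure AgreeAE (lam : ℝ) (f g : ℝ → E) : Prop where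
  comp_cosh : ∀ᵐ u ∂(gegenbauerMeasure lam), f (cosh u) = g (cosh u)
  comp_coshSide : ∀ t, 0 ≤ t → ∀ᵐ x ∂(gegenbauerMeasure lam),
    ∀ᵐ φ ∂(volume.restrict (Ioo 0 π)), f (coshSide x t φ) = g (coshSide x t φ)

lemma ae_angularMeasure_iff {P : ℝ → Prop} :
    (∀ᵐ φ ∂(angularMeasure lam), P φ) ↔ ∀ᵐ φ ∂(volume.restrict (Ioo 0 π)), P φ := by
  rw [angularMeasure, ae_withDensity_iff (measurable_angular_density lam)]
  refine Filter.eventually_congr ?_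
  filter_upwards [ae_restrict_mem measurableSet_Ioo] with φ hφ
  have : 0 < sin φ ^ (2 * lam - 1) := rpow_pos_of_pos (sin_pos_of_mem_Ioo hφ) _
  simp [this]

lemma exists_stronglyMeasurable_agreeAE
    (hf : AEStronglyMeasurable (fun u => f (cosh u)) (gegenbauerMeasure lam)) :
    ∃ g : ℝ → E, StronglyMeasurable g ∧ AgreeAE lam f g := by
  refine ⟨fun z => hf.mk _ (arcosh z), hf.stronglyMeasurable_mk.comp_measurable measurable_arcosh,
    ?_, fun t ht => ?_⟩
  · filter_upwards [hf.ae_eq_mk, ae_gegenbauerMeasure_pos lam] with u hu hu0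
    rw [arcosh_cosh hu0.le]
    exact hu
  · filter_upwards [ae_ae_coshSide hf.ae_eq_mk t, ae_gegenbauerMeasure_pos lam] with x hx hx0
    filter_upwards [ae_angularMeasure_iff.1 hx] with φ hφ
    rw [← hφ, cosh_arcosh (one_le_coshSide hx0.le ht φ)]

lemma AgreeAE.norm (h : AgreeAE lam f g) : AgreeAE lam (fun y => ‖f y‖) (fun y => ‖g y‖) :=
  ⟨by filter_upwards [h.comp_cosh] with t ht; rw [ht],
    fun t ht => by
      filter_upwards [h.comp_coshSide t ht] with x hx
      filter_upwards [hx] with φ hφ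
      rw [hφ]⟩

lemma AgreeAE.memLp (h : AgreeAE lam f g) (hf : MemGegenbauerLp lam p f) : MemGegenbauerLp lam p g :=
  MemLp.ae_eq h.comp_cosh hf

lemma AgreeAE.gegenbauerNorm_eq (h : AgreeAE lam f g) (p : ℝ) :
    gegenbauerNorm lam p f = gegenbauerNorm lam p g :=
  eLpNorm_congr_ae h.comp_cosh

/-- Self-adjointness moves the shift from the function to the Riesz kernel. -/
lemma lintegral_kernel_mul_shift (hf : StronglyMeasurable f) (t : ℝ) :
    ∫⁻ x, rieszKernelENN lam α (cosh x) *
        ∫⁻ φ, ‖f (coshSide x t φ)‖ₑ ∂(angularMeasure lam) ∂(gegenbauerMeasure lam)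
      = shiftConv lam (rieszKernelENN lam α) (fun u => ‖f (cosh u)‖ₑ) t := by
  have h := lintegral_coshSide_symm lam t (rieszKernelENN lam α) (fun z => ‖f z‖ₑ)
    (measurable_rieszKernelENN lam α) hf.enorm
  simp_rw [coshSide_comm _ t] at h
  rw [shiftConv, ← h]
  congr 1 with x
  rw [lintegral_const_mul _ (measurable_kernel_right hf.enorm t x)]
  simp_rw [coshSide_comm x t]

/-! ### Passage to Bochner integrals -/

variable [NormedSpace ℝ E]

/-- The normalizing factor of the generalized shift. -/
def shiftFactor (lam : ℝ) : ℝ := Gamma (lam + 1 / 2) / (Gamma (1 / 2) * Gamma lam)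

lemma shiftFactor_pos (hlam : 0 < lam) : 0 < shiftFactor lam :=
  div_pos (Gamma_pos_of_pos (by positivity))
    (mul_pos (Gamma_pos_of_pos (by norm_num)) (Gamma_pos_of_pos hlam))

lemma gegenbauerShift_eq (lam t : ℝ) (f : ℝ → E) (x : ℝ) :
    gegenbauerShift lam t f x = shiftFactor lam •
      ∫ φ in Ioo 0 π, (sin φ ^ (2 * lam - 1)) • f (coshSide x t φ) := by
  rw [gegenbauerShift, intervalIntegral.integral_of_le pi_pos.le, restrict_Ioo_eq_restrict_Ioc]
  rfl

lemma lintegral_enorm_shiftIntegrand (lam t : ℝ) (f : ℝ → E) (x : ℝ) :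
    ∫⁻ φ in Ioo 0 π, ‖(sin φ ^ (2 * lam - 1)) • f (coshSide x t φ)‖ₑ
      = ∫⁻ φ, ‖f (coshSide x t φ)‖ₑ ∂(angularMeasure lam) := by
  rw [lintegral_angularMeasure]
  refine setLIntegral_congr_fun measurableSet_Ioo fun φ hφ => ?_
  simp only [enorm_smul]
  rw [Real.enorm_of_nonneg (rpow_nonneg (sin_pos_of_mem_Ioo hφ).le _)]

lemma enorm_gegenbauerShift_le (hlam : 0 < lam) (t : ℝ) (f : ℝ → E) (x : ℝ) :
    ‖gegenbauerShift lam t f x‖ₑ ≤ ENNReal.ofReal (shiftFactor lam) *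
      ∫⁻ φ, ‖f (coshSide x t φ)‖ₑ ∂(angularMeasure lam) := by
  rw [gegenbauerShift_eq, enorm_smul, Real.enorm_of_nonneg (shiftFactor_pos hlam).le,
    ← lintegral_enorm_shiftIntegrand]
  gcongr
  exact enorm_integral_le_lintegral_enorm _

lemma stronglyMeasurable_shiftIntegrand (lam : ℝ) (hf : StronglyMeasurable f) :
    StronglyMeasurable (fun p : (ℝ × ℝ) × ℝ =>
      (sin p.2 ^ (2 * lam - 1)) • f (coshSide p.1.1 p.1.2 p.2)) := by
  have h1 : Measurable (fun p : (ℝ × ℝ) × ℝ => sin p.2 ^ (2 * lam - 1)) := by fun_prop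
  refine h1.stronglyMeasurable.smul (hf.comp_measurable ?_)
  unfold coshSide; fun_prop

lemma intervalIntegrable_shiftIntegrand (hf : StronglyMeasurable f) {x t : ℝ}
    (h : ∫⁻ φ, ‖f (coshSide x t φ)‖ₑ ∂(angularMeasure lam) < ∞) :
    IntervalIntegrable (gegenbauerShiftIntegrand lam t f x) volume 0 π := by
  rw [intervalIntegrable_iff_integrableOn_Ioc_of_le pi_pos.le, IntegrableOn,
    ← restrict_Ioo_eq_restrict_Ioc]
  refine ⟨?_, ?_⟩
  · exact ((stronglyMeasurable_shiftIntegrand lam hf).comp_measurable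
      (g := fun φ : ℝ => ((x, t), φ)) (by fun_prop)).aestronglyMeasurable
  · rw [← lintegral_enorm_shiftIntegrand] at h
    exact h

lemma stronglyMeasurable_gegenbauerShift (lam : ℝ) (hf : StronglyMeasurable f) :
    StronglyMeasurable (fun p : ℝ × ℝ => gegenbauerShift lam p.2 f p.1) := by
  simp only [gegenbauerShift_eq]
  exact ((stronglyMeasurable_shiftIntegrand lam hf).integral_prod_right
    (ν := volume.restrict (Ioo 0 π))).const_smul _

lemma stronglyMeasurable_rieszKernel (lam α : ℝ) : StronglyMeasurable (rieszKernel lam α) :=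
  (measurable_rieszKernel lam α).stronglyMeasurable

lemma enorm_rieszKernel (lam α z : ℝ) : ‖rieszKernel lam α z‖ₑ = rieszKernelENN lam α z :=
  Real.enorm_of_nonneg (rieszKernel_nonneg lam α z)

/-- The shifted kernel is finite almost everywhere, being the sum of an integrable and a bounded
function. -/
lemma ae_lintegral_kernel_lt_top (hlam : 0 < lam) (hα : 0 < α) (hα' : α < 2 * lam + 1) (x : ℝ) :
    ∀ᵐ t ∂(gegenbauerMeasure lam),
      ∫⁻ φ, rieszKernelENN lam α (coshSide x t φ) ∂(angularMeasure lam) < ∞ := by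
  have hm := angularMeasure_univ_lt_top hlam
  have h1 : ∫⁻ t, ∫⁻ φ, nearKernel lam α 1 (coshSide x t φ)
      ∂(angularMeasure lam) ∂(gegenbauerMeasure lam) ≠ ∞ := by
    rw [lintegral_kernel (measurable_nearKernel lam α 1)]
    exact ENNReal.mul_ne_top hm.ne ((lintegral_nearKernel_le lam hα zero_le_one).trans_lt
      ENNReal.ofReal_lt_top).ne
  have hmeas := (measurable_kernel_prod (measurable_nearKernel lam α 1) x).lintegral_prod_right'
    (ν := angularMeasure lam)
  filter_upwards [ae_lt_top hmeas h1] with t ht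
  have e : ∀ φ, rieszKernelENN lam α (coshSide x t φ)
      = nearKernel lam α 1 (coshSide x t φ) + farKernel lam α 1 (coshSide x t φ) :=
    fun φ => (nearKernel_add_farKernel lam α 1 _).symm
  simp only [e]
  rw [lintegral_add_left (measurable_kernel_right (measurable_nearKernel lam α 1) x t)]
  refine ENNReal.add_lt_top.2 ⟨ht, ?_⟩
  calc _ ≤ ∫⁻ _, ENNReal.ofReal (1 ^ (α - 2 * lam - 1)) ∂(angularMeasure lam) :=
        lintegral_mono fun φ => farKernel_cosh_le lam hα' one_pos _
    _ < ∞ := by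
        rw [lintegral_const]
        exact ENNReal.mul_lt_top ENNReal.ofReal_lt_top hm

lemma gegenbauerShift_rieszKernel_nonneg (hlam : 0 < lam) (t x : ℝ) :
    0 ≤ gegenbauerShift lam t (rieszKernel lam α) x := by
  rw [gegenbauerShift_eq]
  refine mul_nonneg (shiftFactor_pos hlam).le
    (setIntegral_nonneg measurableSet_Ioo fun φ hφ => ?_)
  exact mul_nonneg (rpow_nonneg (sin_pos_of_mem_Ioo hφ).le _) (rieszKernel_nonneg _ _ _)

lemma ofReal_gegenbauerShift_rieszKernel (hlam : 0 < lam) {x t : ℝ}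
    (h : ∫⁻ φ, rieszKernelENN lam α (coshSide x t φ) ∂(angularMeasure lam) < ∞) :
    ENNReal.ofReal (gegenbauerShift lam t (rieszKernel lam α) x)
      = ENNReal.ofReal (shiftFactor lam) *
        ∫⁻ φ, rieszKernelENN lam α (coshSide x t φ) ∂(angularMeasure lam) := by
  have h' : ∫⁻ φ, ‖rieszKernel lam α (coshSide x t φ)‖ₑ ∂(angularMeasure lam) < ∞ := by
    simpa only [enorm_rieszKernel] using h
  have hi : IntervalIntegrable (fun φ => (sin φ ^ (2 * lam - 1)) •
      rieszKernel lam α (coshSide x t φ)) volume 0 π :=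
    intervalIntegrable_shiftIntegrand (stronglyMeasurable_rieszKernel lam α) h'
  rw [intervalIntegrable_iff_integrableOn_Ioc_of_le pi_pos.le, IntegrableOn,
    ← restrict_Ioo_eq_restrict_Ioc] at hi
  rw [gegenbauerShift_eq, smul_eq_mul, ENNReal.ofReal_mul (shiftFactor_pos hlam).le]
  congr 1
  have hpos : ∀ φ ∈ Ioo 0 π, 0 ≤ (sin φ ^ (2 * lam - 1)) • rieszKernel lam α (coshSide x t φ) :=
    fun φ hφ => mul_nonneg (rpow_nonneg (sin_pos_of_mem_Ioo hφ).le _) (rieszKernel_nonneg _ _ _)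
  simp only [← enorm_rieszKernel]
  rw [← lintegral_enorm_shiftIntegrand, ofReal_integral_eq_lintegral_ofReal hi]
  · refine setLIntegral_congr_fun measurableSet_Ioo fun φ hφ => ?_
    exact (Real.enorm_of_nonneg (hpos φ hφ)).symm
  · filter_upwards [ae_restrict_mem measurableSet_Ioo] with φ hφ using hpos φ hφ

lemma lintegral_enorm_fractional_le (hlam : 0 < lam) (f : ℝ → E) (x : ℝ) :
    ∫⁻ t, ‖gegenbauerShift lam t (rieszKernel lam α) x • f (cosh t)‖ₑ ∂(gegenbauerMeasure lam)
      ≤ ENNReal.ofReal (shiftFactor lam) *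
        shiftConv lam (rieszKernelENN lam α) (fun u => ‖f (cosh u)‖ₑ) x := by
  unfold shiftConv
  rw [← lintegral_const_mul' _ _ (by simp)]
  refine lintegral_mono fun t => ?_
  rw [enorm_smul, lintegral_mul_const _
    (measurable_kernel_right (measurable_rieszKernelENN lam α) x t), ← mul_assoc]
  gcongr
  refine (enorm_gegenbauerShift_le hlam t _ x).trans_eq ?_
  simp only [enorm_rieszKernel]

lemma enorm_rieszFractionalIntegral_le (hlam : 0 < lam) (f : ℝ → E) (x : ℝ) :
    ‖rieszFractionalIntegral lam α f x‖ₑ ≤ ENNReal.ofReal (shiftFactor lam) *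
        shiftConv lam (rieszKernelENN lam α) (fun u => ‖f (cosh u)‖ₑ) x :=
  (enorm_integral_le_lintegral_enorm _).trans (lintegral_enorm_fractional_le hlam f x)

lemma rieszFractionalIntegralConverges_of_lt_top (hlam : 0 < lam) (hα : 0 < α)
    (hα' : α < 2 * lam + 1) (hf : StronglyMeasurable f) {x : ℝ}
    (h : shiftConv lam (rieszKernelENN lam α) (fun u => ‖f (cosh u)‖ₑ) x < ∞) :
    RieszFractionalIntegralConverges lam α f x := by
  refine ⟨?_, ?_, ?_⟩
  · filter_upwards [ae_lintegral_kernel_lt_top hlam hα hα' x] with t ht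
    refine intervalIntegrable_shiftIntegrand (stronglyMeasurable_rieszKernel lam α) ?_
    simpa only [enorm_rieszKernel] using ht
  · exact (((stronglyMeasurable_gegenbauerShift lam
      (stronglyMeasurable_rieszKernel lam α)).comp_measurable
        (g := fun t : ℝ => (x, t)) (by fun_prop)).smul
          (hf.comp_measurable measurable_cosh)).aestronglyMeasurable
  · exact (lintegral_enorm_fractional_le hlam f x).trans_lt
      (ENNReal.mul_lt_top ENNReal.ofReal_lt_top h)

lemma stronglyMeasurable_rieszFractionalIntegral (lam α : ℝ) (hf : StronglyMeasurable f) :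
    StronglyMeasurable (rieszFractionalIntegral lam α f) := by
  unfold rieszFractionalIntegral
  refine StronglyMeasurable.integral_prod_right'
    (f := fun p : ℝ × ℝ => gegenbauerShift lam p.2 (rieszKernel lam α) p.1 • f (cosh p.2)) ?_
  exact (stronglyMeasurable_gegenbauerShift lam (stronglyMeasurable_rieszKernel lam α)).smul
    (hf.comp_measurable (by fun_prop))

/-- For a nonnegative function the fractional integral is exactly the generalized convolution. -/
lemma enorm_rieszFractionalIntegral_of_nonneg (hlam : 0 < lam) (hα : 0 < α)
    (hα' : α < 2 * lam + 1) {g : ℝ → ℝ} (hg : StronglyMeasurable g) (hg0 : ∀ y, 0 ≤ g y) {x : ℝ}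
    (h : shiftConv lam (rieszKernelENN lam α) (fun u => ‖g (cosh u)‖ₑ) x < ∞) :
    ‖rieszFractionalIntegral lam α g x‖ₑ = ENNReal.ofReal (shiftFactor lam) *
        shiftConv lam (rieszKernelENN lam α) (fun u => ‖g (cosh u)‖ₑ) x := by
  have hc := rieszFractionalIntegralConverges_of_lt_top hlam hα hα' hg h
  have hnn : ∀ t, 0 ≤ gegenbauerShift lam t (rieszKernel lam α) x • g (cosh t) := fun t =>
    mul_nonneg (gegenbauerShift_rieszKernel_nonneg hlam t x) (hg0 _)
  rw [rieszFractionalIntegral, Real.enorm_of_nonneg (integral_nonneg hnn),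
    ofReal_integral_eq_lintegral_ofReal hc.2 (Filter.Eventually.of_forall hnn)]
  unfold shiftConv
  rw [← lintegral_const_mul' _ _ (by simp)]
  refine lintegral_congr_ae ?_
  filter_upwards [ae_lintegral_kernel_lt_top hlam hα hα' x] with t ht
  rw [smul_eq_mul, ENNReal.ofReal_mul (gegenbauerShift_rieszKernel_nonneg hlam t x),
    ofReal_gegenbauerShift_rieszKernel hlam ht, lintegral_mul_const _
    (measurable_kernel_right (measurable_rieszKernelENN lam α) x t),
    Real.enorm_of_nonneg (hg0 _), mul_assoc]

/-! ### The potential -/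

/-- Everything needed about the potential at a point where the generalized convolution of `‖f‖`
with the Riesz kernel is finite. -/
lemma rieszPotential_of_lt_top (hlam : 0 < lam) (hlam' : lam < 1 / 2) (hα : 0 < α)
    (hα' : α < 2 * lam + 1) :
    ∃ C : ℝ, 0 < C ∧ ∀ f : ℝ → E, StronglyMeasurable f → ∀ t : ℝ,
      shiftConv lam (rieszKernelENN lam α) (fun u => ‖f (cosh u)‖ₑ) t < ∞ →
      RieszPotentialConverges lam α f t ∧
      ‖rieszPotential lam α f t‖ₑ ≤ ENNReal.ofReal C *
        shiftConv lam (rieszKernelENN lam α) (fun u => ‖f (cosh u)‖ₑ) t := by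
  obtain ⟨C, hC, hker⟩ := lintegral_gegenbauerHeat_le hlam hlam' hα hα'
  have hG : 0 < Gamma (α / 2) := Gamma_pos_of_pos (by positivity)
  have hsf := shiftFactor_pos hlam
  refine ⟨1 / Gamma (α / 2) * (C * shiftFactor lam), by positivity, fun f hf t h => ?_⟩
  have hle : ∫⁻ x, ‖potentialKernel lam α x • gegenbauerShift lam t f x‖ₑ ∂(gegenbauerMeasure lam)
      ≤ ENNReal.ofReal (C * shiftFactor lam) *
        shiftConv lam (rieszKernelENN lam α) (fun u => ‖f (cosh u)‖ₑ) t := by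
    rw [← lintegral_kernel_mul_shift hf, ← lintegral_const_mul' _ _ (by simp)]
    refine lintegral_mono_ae ?_
    filter_upwards [ae_gegenbauerMeasure_pos lam] with x hx
    rw [enorm_smul]
    calc _ ≤ ENNReal.ofReal (C * rieszKernel lam α (cosh x)) * (ENNReal.ofReal (shiftFactor lam) *
          ∫⁻ φ, ‖f (coshSide x t φ)‖ₑ ∂(angularMeasure lam)) := by
          gcongr
          · exact (enorm_integral_le_lintegral_enorm _).trans (hker x hx)
          · exact enorm_gegenbauerShift_le hlam t f x
      _ = _ := by
          rw [ENNReal.ofReal_mul hC.le, ENNReal.ofReal_mul hC.le, rieszKernelENN]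
          ring
  have hmeasA : Measurable (fun x => ∫⁻ φ, ‖f (coshSide x t φ)‖ₑ ∂(angularMeasure lam)) := by
    simp_rw [coshSide_comm _ t]
    exact (measurable_kernel_prod hf.enorm t).lintegral_prod_right'
  have hfin : ∀ᵐ x ∂(gegenbauerMeasure lam),
      ∫⁻ φ, ‖f (coshSide x t φ)‖ₑ ∂(angularMeasure lam) < ∞ := by
    rw [← lintegral_kernel_mul_shift hf] at h
    have hm : Measurable (fun x => rieszKernelENN lam α (cosh x) *
        ∫⁻ φ, ‖f (coshSide x t φ)‖ₑ ∂(angularMeasure lam)) :=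
      ((measurable_rieszKernelENN lam α).comp measurable_cosh).mul hmeasA
    filter_upwards [ae_lt_top hm h.ne, ae_gegenbauerMeasure_pos lam] with x hx hx0
    refine ENNReal.lt_top_of_mul_ne_top_right hx.ne ?_
    rw [rieszKernelENN, rieszKernel_cosh lam α hx0.le]
    simpa using rpow_pos_of_pos (sinh_pos_iff.2 hx0) _
  refine ⟨⟨?_, ?_, ?_⟩, ?_⟩
  · filter_upwards [hfin, ae_gegenbauerMeasure_pos lam] with x hx hx0
    refine ⟨fun r hr => integrableOn_gegenbauerHeatIntegrand hlam hlam' hr, ⟨?_, ?_⟩,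
      intervalIntegrable_shiftIntegrand hf hx⟩
    · refine (Measurable.mul (by fun_prop) ?_).aestronglyMeasurable
      exact (measurable_gegenbauerHeat lam).comp (f := fun r : ℝ => (x, r)) (by fun_prop)
    · exact (hker x hx0).trans_lt ENNReal.ofReal_lt_top
  · exact ((measurable_potentialKernel lam α).stronglyMeasurable.smul
      ((stronglyMeasurable_gegenbauerShift lam hf).comp_measurable
        (g := fun x : ℝ => (x, t)) (by fun_prop))).aestronglyMeasurable
  · exact hle.trans_lt (ENNReal.mul_lt_top ENNReal.ofReal_lt_top h)
  · rw [rieszPotential, enorm_smul, Real.enorm_of_nonneg (by positivity),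
      ENNReal.ofReal_mul (by positivity), mul_assoc]
    gcongr
    exact (enorm_integral_le_lintegral_enorm _).trans hle

lemma stronglyMeasurable_rieszPotential (lam α : ℝ) (hf : StronglyMeasurable f) :
    StronglyMeasurable (rieszPotential lam α f) := by
  unfold rieszPotential
  refine (StronglyMeasurable.integral_prod_right'
    (f := fun p : ℝ × ℝ => potentialKernel lam α p.2 • gegenbauerShift lam p.1 f p.2)
      ?_).const_smul _
  exact (((measurable_potentialKernel lam α).comp measurable_snd).stronglyMeasurable).smul
    ((stronglyMeasurable_gegenbauerShift lam hf).comp_measurable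
      (g := fun p : ℝ × ℝ => (p.2, p.1)) (by fun_prop))

namespace AgreeAE

lemma rieszFractionalIntegral_eq (h : AgreeAE lam f g) (α : ℝ) :
    rieszFractionalIntegral lam α f = rieszFractionalIntegral lam α g := by
  funext x
  refine integral_congr_ae ?_
  filter_upwards [h.comp_cosh] with t ht
  rw [ht]

lemma converges_iff (h : AgreeAE lam f g) (α x : ℝ) :
    RieszFractionalIntegralConverges lam α f x ↔ RieszFractionalIntegralConverges lam α g x := by
  refine and_congr_right fun _ => integrable_congr ?_
  filter_upwards [h.comp_cosh] with t ht
  rw [ht]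

lemma gegenbauerShift_ae_eq (h : AgreeAE lam f g) {t : ℝ} (ht : 0 ≤ t) :
    ∀ᵐ x ∂(gegenbauerMeasure lam), gegenbauerShift lam t f x = gegenbauerShift lam t g x := by
  filter_upwards [h.comp_coshSide t ht] with x hx
  rw [gegenbauerShift_eq, gegenbauerShift_eq]
  congr 1
  refine integral_congr_ae ?_
  filter_upwards [hx] with φ hφ
  rw [hφ]

lemma rieszPotential_eq (h : AgreeAE lam f g) (α : ℝ) {t : ℝ} (ht : 0 ≤ t) :
    rieszPotential lam α f t = rieszPotential lam α g t := by
  unfold rieszPotential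
  congr 1
  refine integral_congr_ae ?_
  filter_upwards [h.gegenbauerShift_ae_eq ht] with x hx
  rw [hx]

lemma potentialConverges (h : AgreeAE lam f g) (α : ℝ) {t : ℝ} (ht : 0 ≤ t)
    (hg : RieszPotentialConverges lam α g t) :
    RieszPotentialConverges lam α f t := by
  refine ⟨?_, hg.2.congr ?_⟩
  · filter_upwards [hg.1, h.comp_coshSide t ht] with x hx hx'
    refine ⟨hx.1, hx.2.1, ?_⟩
    have h3 := hx.2.2
    rw [intervalIntegrable_iff_integrableOn_Ioc_of_le pi_pos.le, IntegrableOn,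
      ← restrict_Ioo_eq_restrict_Ioc] at h3 ⊢
    refine h3.congr ?_
    filter_upwards [hx'] with φ hφ
    exact congrArg (fun v => (sin φ ^ (2 * lam - 1)) • v) hφ.symm
  · filter_upwards [h.gegenbauerShift_ae_eq ht] with x hx
    rw [hx]

end AgreeAE

end transfer

/-! ### Norm estimates -/

section estimates

variable {E : Type*} [NormedAddCommGroup E] {lam α p q : ℝ} {f : ℝ → E}

lemma gegenbauerLp_eLpNorm_eq {s : ℝ} (hs : 0 < s) (g : ℝ → E) :
    eLpNorm g (ENNReal.ofReal s) (gegenbauerMeasure lam)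
      = (∫⁻ t, ‖g t‖ₑ ^ s ∂(gegenbauerMeasure lam)) ^ (1 / s) := by
  rw [eLpNorm_eq_lintegral_rpow_enorm_toReal (by simpa using hs) ENNReal.ofReal_ne_top,
    ENNReal.toReal_ofReal hs.le]

lemma lintegral_rpow_ne_top (hp : 0 < p) (hf : MemGegenbauerLp lam p f) :
    ∫⁻ t, ‖f (cosh t)‖ₑ ^ p ∂(gegenbauerMeasure lam) ≠ ∞ := by
  have h := hf.2
  rw [gegenbauerLp_eLpNorm_eq hp] at h
  intro hcon
  simp [hcon, hp] at h

lemma eLpNorm_le_of_shiftConv (hq : 0 < q) {F : Type*} [NormedAddCommGroup F] {g : ℝ → F}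
    {A B : ℝ} (hA : 0 < A) {N : ℝ≥0∞}
    (hg : ∀ᵐ x ∂(gegenbauerMeasure lam), ‖g x‖ₑ ≤ ENNReal.ofReal A *
      shiftConv lam (rieszKernelENN lam α) (fun u => ‖f (cosh u)‖ₑ) x)
    (hN : (∫⁻ x, shiftConv lam (rieszKernelENN lam α) (fun u => ‖f (cosh u)‖ₑ) x ^ q
      ∂(gegenbauerMeasure lam)) ^ (1 / q) ≤ ENNReal.ofReal B * N) :
    eLpNorm g (ENNReal.ofReal q) (gegenbauerMeasure lam) ≤ ENNReal.ofReal (A * B) * N := by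
  rw [gegenbauerLp_eLpNorm_eq hq]
  calc _ ≤ (∫⁻ x, (ENNReal.ofReal A *
        shiftConv lam (rieszKernelENN lam α) (fun u => ‖f (cosh u)‖ₑ) x) ^ q
          ∂(gegenbauerMeasure lam)) ^ (1 / q) := by
        gcongr ?_ ^ (1 / q)
        refine lintegral_mono_ae ?_
        filter_upwards [hg] with x hx
        gcongr
    _ = ENNReal.ofReal A * (∫⁻ x,
        shiftConv lam (rieszKernelENN lam α) (fun u => ‖f (cosh u)‖ₑ) x ^ q
          ∂(gegenbauerMeasure lam)) ^ (1 / q) := by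
        simp_rw [ENNReal.mul_rpow_of_nonneg _ _ hq.le]
        rw [lintegral_const_mul' _ _ (ENNReal.rpow_ne_top_of_nonneg hq.le ENNReal.ofReal_ne_top),
          ENNReal.mul_rpow_of_nonneg _ _ (by positivity), one_div, ENNReal.rpow_rpow_inv hq.ne']
    _ ≤ ENNReal.ofReal A * (ENNReal.ofReal B * N) := by gcongr
    _ = _ := by rw [ENNReal.ofReal_mul hA.le, mul_assoc]

/-- The generalized convolution of an `L_{p,λ}` function with the Riesz kernel is finite almost
everywhere. -/
lemma ae_shiftConv_lt_top (hlam : 0 < lam) (hα : 0 < α) (hα' : α < 2 * lam + 1) (hp : 1 ≤ p)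
    (hp' : p < (2 * lam + 1) / α) (hpq : 1 / p - 1 / q = α / (2 * lam + 1))
    (hf : StronglyMeasurable f) (hfp : MemGegenbauerLp lam p f) :
    ∀ᵐ x ∂(gegenbauerMeasure lam),
      shiftConv lam (rieszKernelENN lam α) (fun u => ‖f (cosh u)‖ₑ) x < ∞ := by
  have hq : 0 < q := exponent_pos hlam hα hp hp' hpq
  have hfm : Measurable (fun u => ‖f (cosh u)‖ₑ) := (hf.comp_measurable measurable_cosh).enorm
  have hSm := measurable_shiftConv lam (measurable_rieszKernelENN lam α) hfm
  have hI := lintegral_rpow_ne_top (by linarith) hfp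
  rcases hp.eq_or_lt with rfl | hp1
  · obtain ⟨C, hC, hw⟩ := shiftConv_weak_type hlam hα hα' (by simpa using hpq)
    simp only [ENNReal.rpow_one] at hI
    set F := ∫⁻ t, ‖f (cosh t)‖ₑ ∂(gegenbauerMeasure lam) with hF
    have hle : ∀ n : ℕ, gegenbauerMeasure lam
        {x | shiftConv lam (rieszKernelENN lam α) (fun u => ‖f (cosh u)‖ₑ) x = ∞}
          ≤ (ENNReal.ofReal (C / ((n : ℝ) + 1)) * F) ^ q := by
      intro n
      refine (measure_mono fun x hx => ?_).trans (hw _ hfm hI ((n : ℝ) + 1) (by positivity))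
      simp only [mem_ofPred_eq] at hx ⊢
      rw [hx]
      exact ENNReal.ofReal_lt_top
    have hlim : Filter.Tendsto (fun n : ℕ => (ENNReal.ofReal (C / ((n : ℝ) + 1)) * F) ^ q)
        Filter.atTop (nhds 0) := by
      have h1 : Filter.Tendsto (fun n : ℕ => ENNReal.ofReal (C / ((n : ℝ) + 1)))
          Filter.atTop (nhds 0) := by
        have h2 := (tendsto_one_div_add_atTop_nhds_zero_nat (𝕜 := ℝ)).const_mul C
        simp only [mul_one_div, mul_zero] at h2
        simpa using ENNReal.tendsto_ofReal h2
      have h3 := ENNReal.Tendsto.mul_const h1 (b := F) (Or.inr hI)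
      rw [zero_mul] at h3
      have h4 := h3.ennrpow_const q
      rwa [ENNReal.zero_rpow_of_pos hq] at h4
    have h0 := le_antisymm (ge_of_tendsto' hlim hle) zero_le
    rw [ae_iff]
    simpa only [not_lt_top_iff] using h0
  · obtain ⟨C, hC, hs⟩ := shiftConv_strong_type hlam hα hp1 hp' hpq
    have h := hs _ hfm (fun t => by simp) hI
    have hne : ∫⁻ x, shiftConv lam (rieszKernelENN lam α) (fun u => ‖f (cosh u)‖ₑ) x ^ q
        ∂(gegenbauerMeasure lam) ≠ ∞ := by
      intro hcon
      rw [hcon, ENNReal.top_rpow_of_pos (by positivity), top_le_iff] at h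
      exact ENNReal.mul_ne_top ENNReal.ofReal_ne_top
        (ENNReal.rpow_ne_top_of_nonneg (by positivity) hI) h
    filter_upwards [ae_lt_top (hSm.pow_const q) hne] with x hx
    rw [lt_top_iff_ne_top]
    intro hcon
    simp [hcon, hq] at hx

variable [NormedSpace ℝ E]

lemma ae_rieszFractionalIntegralConverges (hlam : 0 < lam) (hα : 0 < α) (hα' : α < 2 * lam + 1)
    (hp : 1 ≤ p) (hp' : p < (2 * lam + 1) / α) (hpq : 1 / p - 1 / q = α / (2 * lam + 1))
    (hf : MemGegenbauerLp lam p f) :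
    ∀ᵐ x ∂(gegenbauerMeasure lam), RieszFractionalIntegralConverges lam α f x := by
  obtain ⟨g, hg, hfg⟩ := exists_stronglyMeasurable_agreeAE hf.1
  filter_upwards [ae_shiftConv_lt_top hlam hα hα' hp hp' hpq hg (hfg.memLp hf)] with x hx
  exact (hfg.converges_iff α x).2 (rieszFractionalIntegralConverges_of_lt_top hlam hα hα' hg hx)

lemma shiftConv_strong_type_gegenbauerNorm (hlam : 0 < lam) (hα : 0 < α) (hp : 1 < p)
    (hp' : p < (2 * lam + 1) / α) (hpq : 1 / p - 1 / q = α / (2 * lam + 1)) :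
    ∃ C : ℝ, 0 < C ∧ ∀ {E : Type _} [NormedAddCommGroup E] (f : ℝ → E), StronglyMeasurable f →
      MemGegenbauerLp lam p f →
      (∫⁻ x, shiftConv lam (rieszKernelENN lam α) (fun u => ‖f (cosh u)‖ₑ) x ^ q
        ∂(gegenbauerMeasure lam)) ^ (1 / q) ≤ ENNReal.ofReal C * gegenbauerNorm lam p f := by
  obtain ⟨C, hC, hs⟩ := shiftConv_strong_type hlam hα hp hp' hpq
  refine ⟨C, hC, fun f hf hfp => ?_⟩
  rw [gegenbauerNorm, gegenbauerLp_eLpNorm_eq (by linarith)]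
  exact hs _ (hf.comp_measurable measurable_cosh).enorm (fun t => by simp)
    (lintegral_rpow_ne_top (by linarith) hfp)

lemma rieszFractionalIntegral_strong_type (E : Type*) [NormedAddCommGroup E] [NormedSpace ℝ E]
    (hlam : 0 < lam) (hα : 0 < α) (hp : 1 < p)
    (hp' : p < (2 * lam + 1) / α) (hpq : 1 / p - 1 / q = α / (2 * lam + 1)) :
    ∃ c : ℝ, 0 < c ∧ ∀ f : ℝ → E, MemGegenbauerLp lam p f →
      MemLp (rieszFractionalIntegral lam α f) (ENNReal.ofReal q) (gegenbauerMeasure lam) ∧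
      eLpNorm (rieszFractionalIntegral lam α f) (ENNReal.ofReal q) (gegenbauerMeasure lam)
        ≤ ENNReal.ofReal c * gegenbauerNorm lam p f := by
  have hq : 0 < q := exponent_pos hlam hα hp.le hp' hpq
  obtain ⟨C, hC, hs⟩ := shiftConv_strong_type_gegenbauerNorm hlam hα hp hp' hpq
  refine ⟨shiftFactor lam * C, mul_pos (shiftFactor_pos hlam) hC, fun f hf => ?_⟩
  obtain ⟨g, hg, hfg⟩ := exists_stronglyMeasurable_agreeAE hf.1
  have hgp := hfg.memLp hf
  have hbound : eLpNorm (rieszFractionalIntegral lam α f) (ENNReal.ofReal q)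
      (gegenbauerMeasure lam) ≤ ENNReal.ofReal (shiftFactor lam * C) * gegenbauerNorm lam p f := by
    rw [hfg.rieszFractionalIntegral_eq, hfg.gegenbauerNorm_eq]
    exact eLpNorm_le_of_shiftConv hq (shiftFactor_pos hlam)
      (Filter.Eventually.of_forall fun x => enorm_rieszFractionalIntegral_le hlam g x) (hs g hg hgp)
  refine ⟨⟨?_, hbound.trans_lt (ENNReal.mul_lt_top ENNReal.ofReal_lt_top hf.2)⟩, hbound⟩
  rw [hfg.rieszFractionalIntegral_eq]
  exact (stronglyMeasurable_rieszFractionalIntegral lam α hg).aestronglyMeasurable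

lemma rieszFractionalIntegral_weak_type (E : Type*) [NormedAddCommGroup E] [NormedSpace ℝ E]
    (hlam : 0 < lam) (hα : 0 < α) (hα' : α < 2 * lam + 1)
    (hpq : 1 - 1 / q = α / (2 * lam + 1)) :
    ∃ c : ℝ, 0 < c ∧ ∀ f : ℝ → E, MemGegenbauerLp lam 1 f → ∀ β : ℝ, 0 < β →
      gegenbauerMeasure lam {t | β < ‖rieszFractionalIntegral lam α f t‖}
        ≤ (ENNReal.ofReal (c / β) * gegenbauerNorm lam 1 f) ^ q := by
  obtain ⟨C, hC, hw⟩ := shiftConv_weak_type hlam hα hα' hpq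
  have hsf := shiftFactor_pos hlam
  refine ⟨C * shiftFactor lam, by positivity, fun f hf β hβ => ?_⟩
  obtain ⟨g, hg, hfg⟩ := exists_stronglyMeasurable_agreeAE hf.1
  have hI := lintegral_rpow_ne_top one_pos (hfg.memLp hf)
  simp only [ENNReal.rpow_one] at hI
  have hnorm : gegenbauerNorm lam 1 f = ∫⁻ t, ‖g (cosh t)‖ₑ ∂(gegenbauerMeasure lam) := by
    rw [hfg.gegenbauerNorm_eq, gegenbauerNorm, gegenbauerLp_eLpNorm_eq one_pos]
    simp
  have h := hw _ (hg.comp_measurable measurable_cosh).enorm hI (β / shiftFactor lam)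
    (by positivity)
  rw [hnorm, show C * shiftFactor lam / β = C / (β / shiftFactor lam) by field_simp,
    hfg.rieszFractionalIntegral_eq]
  refine (measure_mono fun x hx => ?_).trans h
  simp only [mem_ofPred_eq] at hx ⊢
  by_contra hcon
  refine absurd hx (not_lt.2 ?_)
  have h1 := (enorm_rieszFractionalIntegral_le (α := α) hlam g x).trans
    (mul_le_mul_right (not_lt.1 hcon) _)
  rw [← ENNReal.ofReal_mul hsf.le, mul_div_cancel₀ _ hsf.ne', ← ofReal_norm,
    ENNReal.ofReal_le_ofReal_iff hβ.le] at h1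
  exact h1

lemma rieszPotential_strong_type (E : Type*) [NormedAddCommGroup E] [NormedSpace ℝ E]
    (hlam : 0 < lam) (hlam' : lam < 1 / 2) (hα : 0 < α) (hα' : α < 2 * lam + 1) (hp : 1 < p)
    (hp' : p < (2 * lam + 1) / α) (hpq : 1 / p - 1 / q = α / (2 * lam + 1)) :
    ∃ c : ℝ, 0 < c ∧ ∀ f : ℝ → E, MemGegenbauerLp lam p f →
      (∀ᵐ t ∂(gegenbauerMeasure lam), RieszPotentialConverges lam α f t) ∧
      MemLp (rieszPotential lam α f) (ENNReal.ofReal q) (gegenbauerMeasure lam) ∧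
      eLpNorm (rieszPotential lam α f) (ENNReal.ofReal q) (gegenbauerMeasure lam)
        ≤ ENNReal.ofReal c *
          eLpNorm (rieszFractionalIntegral lam α (fun y => ‖f y‖)) (ENNReal.ofReal q)
            (gegenbauerMeasure lam) ∧
      eLpNorm (rieszPotential lam α f) (ENNReal.ofReal q) (gegenbauerMeasure lam)
        ≤ ENNReal.ofReal c * gegenbauerNorm lam p f := by
  have hq : 0 < q := exponent_pos hlam hα hp.le hp' hpq
  have hsf := shiftFactor_pos hlam
  obtain ⟨B, hB, hs⟩ := shiftConv_strong_type_gegenbauerNorm hlam hα hp hp' hpq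
  obtain ⟨A, hA, hpot⟩ := rieszPotential_of_lt_top (E := E) hlam hlam' hα hα'
  set S : (ℝ → E) → ℝ → ℝ≥0∞ := fun g =>
    shiftConv lam (rieszKernelENN lam α) (fun u => ‖g (cosh u)‖ₑ) with hS
  refine ⟨A / shiftFactor lam + A * B, by positivity, fun f hf => ?_⟩
  obtain ⟨g, hg, hfg⟩ := exists_stronglyMeasurable_agreeAE hf.1
  have hgp := hfg.memLp hf
  have hfin : ∀ᵐ x ∂(gegenbauerMeasure lam), S g x < ∞ :=
    ae_shiftConv_lt_top hlam hα hα' hp.le hp' hpq hg hgp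
  have heq : rieszPotential lam α f =ᵐ[gegenbauerMeasure lam] rieszPotential lam α g := by
    filter_upwards [ae_gegenbauerMeasure_pos lam] with t ht using hfg.rieszPotential_eq α ht.le
  have hae : ∀ᵐ t ∂(gegenbauerMeasure lam),
      ‖rieszPotential lam α g t‖ₑ ≤ ENNReal.ofReal A * S g t := by
    filter_upwards [hfin] with t ht using (hpot g hg t ht).2
  have hnorm : eLpNorm (rieszPotential lam α f) (ENNReal.ofReal q) (gegenbauerMeasure lam)
      ≤ ENNReal.ofReal (A * B) * gegenbauerNorm lam p f := by
    rw [eLpNorm_congr_ae heq, hfg.gegenbauerNorm_eq]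
    exact eLpNorm_le_of_shiftConv hq hA hae (hs g hg hgp)
  have hcomp : eLpNorm (rieszPotential lam α f) (ENNReal.ofReal q) (gegenbauerMeasure lam)
      ≤ ENNReal.ofReal (A / shiftFactor lam) *
        eLpNorm (rieszFractionalIntegral lam α (fun y => ‖f y‖)) (ENNReal.ofReal q)
          (gegenbauerMeasure lam) := by
    rw [eLpNorm_congr_ae heq, hfg.norm.rieszFractionalIntegral_eq]
    refine eLpNorm_le_mul_eLpNorm_of_ae_le_mul ?_ _
    filter_upwards [hfin, hae] with t ht hle
    have h1 := enorm_rieszFractionalIntegral_of_nonneg hlam hα hα' hg.norm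
      (fun y => norm_nonneg _) (x := t) (by simpa only [enorm_norm] using ht)
    simp only [enorm_norm] at h1
    rw [← ENNReal.ofReal_le_ofReal_iff (by positivity), ofReal_norm,
      ENNReal.ofReal_mul (by positivity), ofReal_norm, h1, ← mul_assoc,
      ← ENNReal.ofReal_mul (by positivity), div_mul_cancel₀ _ hsf.ne']
    exact hle
  refine ⟨?_, ⟨?_, hnorm.trans_lt (ENNReal.mul_lt_top ENNReal.ofReal_lt_top hf.2)⟩,
    hcomp.trans ?_, hnorm.trans ?_⟩
  · filter_upwards [hfin, ae_gegenbauerMeasure_pos lam] with t ht ht0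
    exact hfg.potentialConverges α ht0.le (hpot g hg t ht).1
  · exact (stronglyMeasurable_rieszPotential lam α hg).aestronglyMeasurable.congr heq.symm
  · gcongr
    linarith [mul_pos hA hB]
  · gcongr
    linarith [div_pos hA hsf]

end estimates

end

theorem theorem3 {𝕜 : Type*} [RCLike 𝕜] (lam α p q : ℝ) (hlam : 0 < lam)
    (hα : 0 < α) (hα' : α < 2 * lam + 1) (hp : 1 ≤ p) (hp' : p < (2 * lam + 1) / α)
    (hpq : 1 / p - 1 / q = α / (2 * lam + 1)) :
    -- (a) absolute convergence
    (∀ f : ℝ → 𝕜, MemGegenbauerLp lam p f →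
      ∀ᵐ x ∂(gegenbauerMeasure lam), RieszFractionalIntegralConverges lam α f x) ∧
    -- (b) strong type `(p, q)` of the fractional integral and of the potential
    (1 < p →
      (∃ c : ℝ, 0 < c ∧ ∀ f : ℝ → 𝕜, MemGegenbauerLp lam p f →
        MemLp (rieszFractionalIntegral lam α f) (ENNReal.ofReal q) (gegenbauerMeasure lam) ∧
        eLpNorm (rieszFractionalIntegral lam α f) (ENNReal.ofReal q) (gegenbauerMeasure lam)
          ≤ ENNReal.ofReal c * gegenbauerNorm lam p f) ∧
      (lam < 1 / 2 → ∃ c : ℝ, 0 < c ∧ ∀ f : ℝ → 𝕜, MemGegenbauerLp lam p f →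
        (∀ᵐ t ∂(gegenbauerMeasure lam), RieszPotentialConverges lam α f t) ∧
        MemLp (rieszPotential lam α f) (ENNReal.ofReal q) (gegenbauerMeasure lam) ∧
        eLpNorm (rieszPotential lam α f) (ENNReal.ofReal q) (gegenbauerMeasure lam)
          ≤ ENNReal.ofReal c *
            eLpNorm (rieszFractionalIntegral lam α (fun y => ‖f y‖)) (ENNReal.ofReal q)
              (gegenbauerMeasure lam) ∧
        eLpNorm (rieszPotential lam α f) (ENNReal.ofReal q) (gegenbauerMeasure lam)
          ≤ ENNReal.ofReal c * gegenbauerNorm lam p f)) ∧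
    -- (c) weak type `(1, q)`
    (p = 1 → ∃ c : ℝ, 0 < c ∧ ∀ f : ℝ → 𝕜, MemGegenbauerLp lam 1 f → ∀ β : ℝ, 0 < β →
      gegenbauerMeasure lam {t | β < ‖rieszFractionalIntegral lam α f t‖}
        ≤ (ENNReal.ofReal (c / β) * gegenbauerNorm lam 1 f) ^ q) := by
  refine ⟨fun f hf => ae_rieszFractionalIntegralConverges hlam hα hα' hp hp' hpq hf,
    fun hp1 => ⟨rieszFractionalIntegral_strong_type 𝕜 hlam hα hp1 hp' hpq,
      fun hlam' => rieszPotential_strong_type 𝕜 hlam hlam' hα hα' hp1 hp' hpq⟩, ?_⟩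
  rintro rfl
  exact rieszFractionalIntegral_weak_type 𝕜 hlam hα hα' (by simpa using hpq)
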